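/- Let $\Omega\subseteq\mathbb R$ be compact, $m_\Omega=\sup_{\omega\in\Omega}|\omega|$ (with $m_\emptyset=0$), and let $B(\Omega)=\{f\in L^2(\mathbb R):\operatorname{supp}\hat f\subseteq\Omega\}$, where $\hat f(\omega)=\int_{\mathbb R} f(x)e^{-i\omega x}\,dx$ (extended to $L^2$) and functions are complex-valued; every $f\in B(\Omega)$ has a unique smooth representative, through which point values of $f$ and its derivatives are taken. Let $$\Phi_\Omega(x)=\frac1{2\pi}\int_\Omega e^{i\omega x}\,d\omega .$$ Let $(x_n)_{n\in\mathbb Z}$ be real numbers with $x_n<x_{n+1}$ for all $n$, let $V_n=\{x\in\mathbb R: |x-x_n|\le|x-x_m|\ \forall m\ne n\}$, $z_n=\frac{x_n+x_{n-1}}2$, and $$\delta=\sup_{x\in\mathbb R}\inf_{n\in\mathbb Z}|x-x_n|\in(0,\infty].$$ For $k\ge1$ let $c_k>0$ be the minimal constant such that $$\int_a^b|f|^2\,dx\le c_k^{2k}(b-a)^{2k}\int_a^b|f^{(k)}|^2\,dx$$ for all $a<b$ and all $f$ in the Sobolev space $H^k(a,b)$ with $f(a)=f'(a)=\dots=f^{(k-1)}(a)=0$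 or $f(b)=f'(b)=\dots=f^{(k-1)}(b)=0$. Theorem. Let $k\ge0$ and suppose that $\delta<\dfrac{1}{c_{k+1}m_\Omega}$ (the right-hand side being $\infty$ if $m_\Omega=0$). For $n\in\mathbb Z$ and $0\le l\le k$ put $$\mu_{n,l}=\frac1{l!}\int_{V_n}(x-x_n)^{2l}\,dx=\frac{(z_{n+1}-x_n)^{2l+1}-(z_n-x_n)^{2l+1}}{l!\,(2l+1)} .$$ Then there are constants $A,B>0$ with $$A\ge e^{-1}\bigl(1-(c_{k+1}\delta m_\Omega)^{k+1}\bigr)^2,\qquad B\le\Bigl(1+\frac{2\delta m_\Omega}\pi\Bigr)^2e^{(\delta m_\Omega)^2},$$ such that $$A\|f\|^2\le\sum_{n\in\mathbb Z}\sum_{l=0}^k\mu_{n,l}|f^{(l)}(x_n)|^2\le B\|f\|^2\qquad\text{for all } f\in B(\Omega),$$ and the functions $\sqrt{\mu_{n,l}}\,\frac{d^l}{dx^l}\Phi_\Omega(\cdot-x_n)$, $n\in\mathbb Z$, $0\le l\le k$, belong to $B(\Omega)$ and form a frame for $B(\Omega)$ with frame bounds $A$ and $B$. Moreover, for any $A,B>0$,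 the displayed sampling inequality with constants $A,B$ holds if and only if these functions form a frame for $B(\Omega)$ with frame bounds $A,B$. -/

import Mathlib

open MeasureTheory Set Topology
open scoped ENNReal NNReal FourierTransform ContDiff

noncomputable section

/-! ### Sobolev functions on an interval and Wirtinger constants -/

/-- `g` is the weak derivative of `f` on the interval `(a, b)`. -/
def HasWeakDerivOn (a b : ℝ) (f g : ℝ → ℂ) : Prop :=
  ∀ φ : ℝ → ℝ, ContDiff ℝ ∞ φ → HasCompactSupport φ → tsupport φ ⊆ Ioo a b →
    ∫ t in a..b, deriv φ t • f t = -∫ t in a..b, φ t • g t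

/-- `D 0` is a function in the Sobolev space `H^k(a, b)` and `D 1, …, D k` are its weak derivatives.
The functions of order less than `k` are represented by their continuous representatives on
`[a, b]`, so that their boundary values make sense. Only `D 0, …, D k` play a role. -/
structure IsSobolevJet (k : ℕ) (a b : ℝ) (D : ℕ → ℝ → ℂ) : Prop where
  memLp : ∀ j ≤ k, MemLp (D j) 2 (volume.restrict (Ioo a b))
  continuousOn : ∀ j < k, ContinuousOn (D j) (Icc a b)
  weakDeriv : ∀ j < k, HasWeakDerivOn a b (D j) (D (j + 1))

/-- The constants `c > 0` for which the Wirtinger inequality of order `k`,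
`∫ |f|² ≤ c^(2k) (b - a)^(2k) ∫ |f^(k)|²` over `(a, b)`, holds on all bounded intervals `(a, b)` and
for all `f ∈ H^k(a, b)` that vanish together with their derivatives of order less than `k`
at `a` or at `b`. -/
def wirtingerSet (k : ℕ) : Set ℝ :=
  {c | 0 < c ∧ ∀ (a b : ℝ), a < b → ∀ D : ℕ → ℝ → ℂ, IsSobolevJet k a b D →
    ((∀ j < k, D j a = 0) ∨ (∀ j < k, D j b = 0)) →
      ∫ t in a..b, ‖D 0 t‖ ^ 2 ≤
        c ^ (2 * k) * (b - a) ^ (2 * k) * ∫ t in a..b, ‖D k t‖ ^ 2}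

/-- The optimal constant `c_k` in the Wirtinger inequality of order `k`
(see `isLeast_wirtingerConst`). -/
def wirtingerConst (k : ℕ) : ℝ := sInf (wirtingerSet k)

theorem norm_sub_le_of_hasWeakDerivOn {a b : ℝ} {f g : ℝ → ℂ}
    (hf : ContinuousOn f (Icc a b)) (hg : IntegrableOn g (Ioo a b))
    (hfg : HasWeakDerivOn a b f g) {x y : ℝ} (hx : x ∈ Ioo a b) (hy : y ∈ Ioo a b) :
    ‖f x - f y‖ ≤ ∫ t in a..b, ‖g t‖ := by
  have hab : a < b := hx.1.trans hx.2
  refine le_of_forall_pos_le_add fun ε hε => ?_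
  -- smooth bumps of integral one close to a point
  have key : ∀ z ∈ Ioo a b, ∃ ρ : ℝ → ℝ, ContDiff ℝ ∞ ρ ∧ HasCompactSupport ρ ∧
      (∃ p q, a < p ∧ q < b ∧ ∀ t, t ∉ Icc p q → ρ t = 0) ∧ (∀ t, 0 ≤ ρ t) ∧
      (∫ t in a..b, ρ t = 1) ∧ ‖(∫ t in a..b, ρ t • f t) - f z‖ ≤ ε / 2 := by
    intro z hz
    have hcz : ContinuousAt f z := hf.continuousAt (Icc_mem_nhds hz.1 hz.2)
    obtain ⟨r, hr, hball⟩ := Metric.continuousAt_iff.1 hcz (ε / 2) (by positivity)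
    obtain ⟨s, hs, hsub⟩ := Metric.isOpen_iff.1 isOpen_Ioo z hz
    set R := min r s / 2 with hR
    have hRpos : 0 < R := by positivity
    have hRr : R < r := by
      have := min_le_left r s
      linarith
    have hRs : R < s := by
      have := min_le_right r s
      linarith
    let B : ContDiffBump z := ⟨R / 2, R, by positivity, by linarith⟩
    have hsupp : ∀ t, t ∉ Icc (z - R) (z + R) → B.normed volume t = 0 := by
      intro t ht
      by_contra h
      have h1 : t ∈ Function.support (B.normed volume) := h
      rw [B.support_normed_eq, Real.ball_eq_Ioo] at h1
      exact ht ⟨h1.1.le, h1.2.le⟩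
    have hpa : a < z - R := by
      have : z - R ∈ Ioo a b := hsub (by simp [abs_of_pos hRpos, hRs])
      exact this.1
    have hqb : z + R < b := by
      have : z + R ∈ Ioo a b := hsub (by simp [abs_of_pos hRpos, hRs])
      exact this.2
    have hint : ∫ t in a..b, B.normed volume t = 1 := by
      rw [intervalIntegral.integral_eq_integral_of_support_subset, B.integral_normed]
      intro t ht
      have : t ∈ Icc (z - R) (z + R) := by
        by_contra h
        exact ht (hsupp t h)
      exact ⟨by linarith [this.1], by linarith [this.2]⟩
    refine ⟨B.normed volume, B.contDiff_normed, B.hasCompactSupport_normed,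
      ⟨z - R, z + R, hpa, hqb, hsupp⟩, B.nonneg_normed, hint, ?_⟩
    have hfi : IntervalIntegrable f volume a b :=
      (hf.mono (by rw [uIcc_of_le hab.le])).intervalIntegrable
    have hi1 : IntervalIntegrable (fun t => B.normed volume t • f t) volume a b :=
      ((B.contDiff_normed (n := 0)).continuous.continuousOn.smul
        (hf.mono (by rw [uIcc_of_le hab.le]))).intervalIntegrable
    have hBi : IntervalIntegrable (B.normed volume) volume a b :=
      ((B.contDiff_normed (n := 0)).continuous).intervalIntegrable _ _
    have hi2 : IntervalIntegrable (fun t => B.normed volume t • f z) volume a b :=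
      ((B.contDiff_normed (n := 0)).continuous.smul continuous_const).intervalIntegrable _ _
    have e1 : (∫ t in a..b, B.normed volume t • f t) - f z =
        ∫ t in a..b, (B.normed volume t • f t - B.normed volume t • f z) := by
      rw [intervalIntegral.integral_sub hi1 hi2, intervalIntegral.integral_smul_const, hint,
        one_smul]
    rw [e1]
    have e2 : ε / 2 = ∫ t in a..b, B.normed volume t * (ε / 2) := by
      rw [intervalIntegral.integral_mul_const, hint, one_mul]
    rw [e2]
    refine intervalIntegral.norm_integral_le_of_norm_le hab.le
      (ae_of_all _ fun t _ => ?_) (hBi.mul_const _)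
    rw [← smul_sub, norm_smul, Real.norm_of_nonneg (B.nonneg_normed t)]
    by_cases ht : t ∈ Icc (z - R) (z + R)
    · refine mul_le_mul_of_nonneg_left ?_ (B.nonneg_normed t)
      have : dist t z < r := by
        rw [Real.dist_eq]
        refine lt_of_le_of_lt (abs_le.2 ⟨?_, ?_⟩) hRr <;> linarith [ht.1, ht.2]
      have := hball this
      rw [dist_eq_norm] at this
      exact this.le
    · rw [hsupp t ht]
      simp
  obtain ⟨ρ, hρ, hρc, ⟨p, q, hp, hq, hρs⟩, hρ0, hρ1, hρf⟩ := key x hx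
  obtain ⟨σ, hσ, hσc, ⟨p', q', hp', hq', hσs⟩, hσ0, hσ1, hσf⟩ := key y hy
  have hρi : ∀ u v, IntervalIntegrable ρ volume u v := fun u v =>
    hρ.continuous.intervalIntegrable u v
  have hσi : ∀ u v, IntervalIntegrable σ volume u v := fun u v =>
    hσ.continuous.intervalIntegrable u v
  let φ : ℝ → ℝ := fun t => ∫ s in a..t, (ρ s - σ s)
  have hφd : ∀ t, HasDerivAt φ (ρ t - σ t) t := fun t =>
    (hρ.continuous.sub hσ.continuous).integral_hasStrictDerivAt a t |>.hasDerivAt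
  have hφd' : deriv φ = fun t => ρ t - σ t := funext fun t => (hφd t).deriv
  have hφ : ContDiff ℝ ∞ φ := by
    rw [contDiff_infty_iff_deriv, hφd']
    exact ⟨fun t => (hφd t).differentiableAt, hρ.sub hσ⟩
  set P := min p p' with hP
  set Q := max q q' with hQ
  have hPa : a < P := lt_min hp hp'
  have hQb : Q < b := max_lt hq hq'
  have hz : ∀ t, t ∉ Icc P Q → ρ t - σ t = 0 := by
    intro t ht
    rw [hρs t, hσs t, sub_zero]
    · intro h
      exact ht ⟨(min_le_right _ _).trans h.1, h.2.trans (le_max_right _ _)⟩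
    · intro h
      exact ht ⟨(min_le_left _ _).trans h.1, h.2.trans (le_max_left _ _)⟩
  have htot : ∫ s in a..b, (ρ s - σ s) = 0 := by
    rw [intervalIntegral.integral_sub (hρi _ _) (hσi _ _), hρ1, hσ1, sub_self]
  have hφs : ∀ t, t ∉ Icc P Q → φ t = 0 := by
    intro t ht
    rw [mem_Icc, not_and_or, not_le, not_le] at ht
    rcases ht with ht | ht
    · refine (intervalIntegral.integral_congr (g := fun _ => (0 : ℝ)) fun s hs => ?_).trans
        (by simp)
      refine hz s fun h => ?_
      have : s ≤ max a t := hs.2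
      have : max a t < P := max_lt hPa ht
      linarith [h.1]
    · have h1 : φ t = (∫ s in a..b, (ρ s - σ s)) + ∫ s in b..t, (ρ s - σ s) :=
        (intervalIntegral.integral_add_adjacent_intervals
          ((hρi _ _).sub (hσi _ _)) ((hρi _ _).sub (hσi _ _))).symm
      rw [h1, htot, zero_add]
      refine (intervalIntegral.integral_congr (g := fun _ => (0 : ℝ)) fun s hs => ?_).trans
        (by simp)
      refine hz s fun h => ?_
      have : min b t ≤ s := hs.1
      have : Q < min b t := lt_min hQb ht
      linarith [h.2]
  have hφt : tsupport φ ⊆ Icc P Q := by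
    refine closure_minimal (fun t ht => ?_) isClosed_Icc
    by_contra h
    exact ht (hφs t h)
  have hφc : HasCompactSupport φ := HasCompactSupport.intro isCompact_Icc hφs
  have hφ1 : ∀ t ∈ Icc a b, ‖φ t‖ ≤ 1 := by
    intro t ht
    have aux : ∀ τ : ℝ → ℝ, Continuous τ → (∀ s, 0 ≤ τ s) → (∫ s in a..b, τ s = 1) →
        0 ≤ ∫ s in a..t, τ s ∧ ∫ s in a..t, τ s ≤ 1 := by
      intro τ hτ h0 h1
      refine ⟨intervalIntegral.integral_nonneg ht.1 fun s _ => h0 s, ?_⟩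
      rw [← h1, ← intervalIntegral.integral_add_adjacent_intervals
        (hτ.intervalIntegrable a t) (hτ.intervalIntegrable t b)]
      have := intervalIntegral.integral_nonneg (μ := volume) ht.2 fun s _ => h0 s
      linarith
    have e : φ t = (∫ s in a..t, ρ s) - ∫ s in a..t, σ s :=
      intervalIntegral.integral_sub (hρi _ _) (hσi _ _)
    have h1 := aux ρ hρ.continuous hρ0 hρ1
    have h2 := aux σ hσ.continuous hσ0 hσ1
    rw [e, Real.norm_eq_abs, abs_le]
    constructor <;> linarith [h1.1, h1.2, h2.1, h2.2]
  have hw := hfg φ hφ hφc (hφt.trans fun t ht => ⟨hPa.trans_le ht.1, ht.2.trans_lt hQb⟩)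
  rw [hφd'] at hw
  have hf' : ContinuousOn f (uIcc a b) := by rwa [uIcc_of_le hab.le]
  have e3 : ∫ t in a..b, (ρ t - σ t) • f t =
      (∫ t in a..b, ρ t • f t) - ∫ t in a..b, σ t • f t := by
    simp_rw [sub_smul]
    exact intervalIntegral.integral_sub
      (hρ.continuous.continuousOn.smul hf').intervalIntegrable
      (hσ.continuous.continuousOn.smul hf').intervalIntegrable
  have hgi : IntervalIntegrable g volume a b :=
    (intervalIntegrable_iff_integrableOn_Ioo_of_le hab.le).2 hg
  have hb : ‖∫ t in a..b, φ t • g t‖ ≤ ∫ t in a..b, ‖g t‖ := by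
    refine intervalIntegral.norm_integral_le_of_norm_le hab.le
      (ae_of_all _ fun t ht => ?_) hgi.norm
    rw [norm_smul]
    exact mul_le_of_le_one_left (norm_nonneg _) (hφ1 t ⟨ht.1.le, ht.2⟩)
  have e4 : f x - f y = (∫ t in a..b, (ρ t - σ t) • f t) -
      (((∫ t in a..b, ρ t • f t) - f x) - ((∫ t in a..b, σ t • f t) - f y)) := by
    rw [e3]
    ring
  rw [e4]
  refine (norm_sub_le _ _).trans (add_le_add ?_ ?_)
  · rw [hw, norm_neg]
    exact hb
  · exact (norm_sub_le _ _).trans (by linarith)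

theorem one_mem_wirtingerSet (k : ℕ) : (1 : ℝ) ∈ wirtingerSet k := by
  refine ⟨one_pos, fun a b hab D hD hbc => ?_⟩
  have hsq : ∀ j ≤ k, IntervalIntegrable (fun t => ‖D j t‖ ^ 2) volume a b := fun j hj =>
    (intervalIntegrable_iff_integrableOn_Ioo_of_le hab.le).2 (hD.memLp j hj).integrable_norm_pow'
  have step : ∀ j < k, ∫ t in a..b, ‖D j t‖ ^ 2 ≤
      (b - a) ^ 2 * ∫ t in a..b, ‖D (j + 1) t‖ ^ 2 := by
    intro j hj
    have hj1 := hD.memLp (j + 1) hj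
    have hg : IntegrableOn (D (j + 1)) (Ioo a b) := hj1.integrable one_le_two
    have hgi : IntervalIntegrable (D (j + 1)) volume a b :=
      (intervalIntegrable_iff_integrableOn_Ioo_of_le hab.le).2 hg
    have hc := hD.continuousOn j hj
    obtain ⟨e, he, he0⟩ : ∃ e ∈ Icc a b, D j e = 0 := by
      rcases hbc with h | h
      · exact ⟨a, ⟨le_rfl, hab.le⟩, h j hj⟩
      · exact ⟨b, ⟨hab.le, le_rfl⟩, h j hj⟩
    set M := ∫ t in a..b, ‖D (j + 1) t‖ with hM
    have hbd : ∀ x ∈ Ioo a b, ‖D j x‖ ≤ M := by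
      intro x hx
      have hcl : e ∈ closure (Ioo a b) := by rwa [closure_Ioo hab.ne]
      have h1 : ContinuousWithinAt (fun y => ‖D j x - D j y‖) (Ioo a b) e :=
        (continuousWithinAt_const.sub ((hc e he).mono Ioo_subset_Icc_self)).norm
      have := h1.closure_le hcl (g := fun _ => M) continuousWithinAt_const fun y hy =>
        norm_sub_le_of_hasWeakDerivOn hc hg (hD.weakDeriv j hj) hx hy
      simpa [he0] using this
    have hM0 : 0 ≤ M := intervalIntegral.integral_nonneg hab.le fun t _ => norm_nonneg _
    have hCS : M ^ 2 ≤ (b - a) * ∫ t in a..b, ‖D (j + 1) t‖ ^ 2 := by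
      have h0 : 0 ≤ ∫ t in a..b, (‖D (j + 1) t‖ - M / (b - a)) ^ 2 :=
        intervalIntegral.integral_nonneg hab.le fun t _ => sq_nonneg _
      have hexp : ∫ t in a..b, (‖D (j + 1) t‖ - M / (b - a)) ^ 2 =
          (∫ t in a..b, ‖D (j + 1) t‖ ^ 2) - M ^ 2 / (b - a) := by
        have : (fun t => (‖D (j + 1) t‖ - M / (b - a)) ^ 2) = fun t =>
            ‖D (j + 1) t‖ ^ 2 - 2 * (M / (b - a)) * ‖D (j + 1) t‖ + (M / (b - a)) ^ 2 := by
          funext t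
          ring
        rw [this, intervalIntegral.integral_add ((hsq _ hj).sub (hgi.norm.const_mul _))
          intervalIntegrable_const, intervalIntegral.integral_sub (hsq _ hj)
          (hgi.norm.const_mul _), intervalIntegral.integral_const_mul,
          intervalIntegral.integral_const, ← hM, smul_eq_mul]
        have : b - a ≠ 0 := (sub_pos.2 hab).ne'
        field_simp
        ring
      rw [hexp, sub_nonneg, div_le_iff₀ (sub_pos.2 hab)] at h0
      linarith
    calc ∫ t in a..b, ‖D j t‖ ^ 2 ≤ ∫ t in a..b, M ^ 2 := by
          refine intervalIntegral.integral_mono_on_of_le_Ioo hab.le (hsq j hj.le)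
            intervalIntegrable_const fun t ht => ?_
          exact pow_le_pow_left₀ (norm_nonneg _) (hbd t ht) 2
      _ = (b - a) * M ^ 2 := by simp
      _ ≤ (b - a) * ((b - a) * ∫ t in a..b, ‖D (j + 1) t‖ ^ 2) :=
          mul_le_mul_of_nonneg_left hCS (sub_pos.2 hab).le
      _ = _ := by ring
  have main : ∀ j ≤ k, ∫ t in a..b, ‖D 0 t‖ ^ 2 ≤
      (b - a) ^ (2 * j) * ∫ t in a..b, ‖D j t‖ ^ 2 := by
    intro j
    induction j with
    | zero => simp
    | succ j ih =>
      intro hj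
      refine (ih (by omega)).trans ?_
      calc _ ≤ (b - a) ^ (2 * j) * ((b - a) ^ 2 * ∫ t in a..b, ‖D (j + 1) t‖ ^ 2) :=
            mul_le_mul_of_nonneg_left (step j hj) (pow_nonneg (sub_pos.2 hab).le _)
        _ = _ := by ring
  simpa using main k le_rfl

/-- The jet of the monomial `t ^ k`. -/
theorem isSobolevJet_pow (k : ℕ) :
    IsSobolevJet k 0 1 (fun j t => ((k.descFactorial j : ℝ) * t ^ (k - j) : ℝ)) := by
  have hcont : ∀ j, Continuous fun t : ℝ => (((k.descFactorial j : ℝ) * t ^ (k - j) : ℝ) : ℂ) :=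
    fun j => by fun_prop
  refine ⟨fun j _ => ?_, fun j _ => (hcont j).continuousOn, fun j hj φ hφ _ hs => ?_⟩
  · rw [memLp_two_iff_integrable_sq_norm (hcont j).aestronglyMeasurable]
    exact (((hcont j).norm.pow 2).continuousOn.integrableOn_compact isCompact_Icc).mono_set
      Ioo_subset_Icc_self
  · have hd : ∀ t : ℝ, HasDerivAt
        (fun t : ℝ => (((k.descFactorial j : ℝ) * t ^ (k - j) : ℝ) : ℂ))
        (((k.descFactorial (j + 1) : ℝ) * t ^ (k - (j + 1)) : ℝ) : ℂ) t := by
      intro t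
      refine HasDerivAt.ofReal_comp ?_
      have h := (hasDerivAt_pow (k - j) t).const_mul (k.descFactorial j : ℝ)
      have e : (k.descFactorial j : ℝ) * (((k - j : ℕ) : ℝ) * t ^ (k - j - 1)) =
          (k.descFactorial (j + 1) : ℝ) * t ^ (k - (j + 1)) := by
        rw [Nat.descFactorial_succ, Nat.sub_sub]
        push_cast
        ring
      rwa [e] at h
    have hφd : ∀ t, HasDerivAt φ (deriv φ t) t := fun t =>
      (hφ.differentiable (by simp) t).hasDerivAt
    have hφd' : Continuous (deriv φ) := hφ.continuous_deriv (by simp)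
    have h0 : φ 0 = 0 := image_eq_zero_of_notMem_tsupport fun h => by simpa using hs h
    have h1 : φ 1 = 0 := image_eq_zero_of_notMem_tsupport fun h => by simpa using hs h
    have := intervalIntegral.integral_smul_deriv_eq_deriv_smul (a := 0) (b := 1)
      (fun t _ => hφd t) (fun t _ => hd t) (hφd'.intervalIntegrable _ _)
      ((hcont (j + 1)).intervalIntegrable _ _)
    rw [this, h0, h1]
    simp

theorem wirtingerSet_lower_bound {k : ℕ} (hk : 0 < k) :
    ∃ ε : ℝ, 0 < ε ∧ ∀ c ∈ wirtingerSet k, ε ≤ c := by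
  set δ : ℝ := 1 / ((2 * k + 1) * (k.factorial : ℝ) ^ 2) with hδ
  have hfac : (0 : ℝ) < k.factorial := by exact_mod_cast k.factorial_pos
  have hδ0 : 0 < δ := by positivity
  refine ⟨min 1 δ, lt_min one_pos hδ0, fun c hc => ?_⟩
  have h := hc.2 0 1 one_pos _ (isSobolevJet_pow k) (Or.inl fun j hj => by
    simp [Nat.sub_ne_zero_of_lt hj])
  have e1 : ∫ t in (0 : ℝ)..1, ‖(((k.descFactorial 0 : ℝ) * t ^ (k - 0) : ℝ) : ℂ)‖ ^ 2 =
      1 / (2 * k + 1) := by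
    have : ∀ t : ℝ, ‖(((k.descFactorial 0 : ℝ) * t ^ (k - 0) : ℝ) : ℂ)‖ ^ 2 = t ^ (2 * k) := by
      intro t
      rw [Complex.norm_real, Real.norm_eq_abs, sq_abs]
      simp [← pow_mul, mul_comm]
    simp_rw [this]
    rw [integral_pow]
    simp
  have e2 : ∫ t in (0 : ℝ)..1, ‖(((k.descFactorial k : ℝ) * t ^ (k - k) : ℝ) : ℂ)‖ ^ 2 =
      (k.factorial : ℝ) ^ 2 := by
    simp [Nat.descFactorial_self]
  rw [e1, e2] at h
  have h3 : δ ≤ c ^ (2 * k) := by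
    rw [hδ, div_le_iff₀ (by positivity)]
    rw [div_le_iff₀ (by positivity)] at h
    calc (1 : ℝ) ≤ _ := h
      _ = _ := by ring
  by_contra hlt
  rw [not_le, lt_min_iff] at hlt
  have : c ^ (2 * k) ≤ c := pow_le_of_le_one hc.1.le hlt.1.le (by omega)
  linarith [hlt.2]

/-- The infimum defining `wirtingerConst` is attained: it is the minimal admissible constant. -/
theorem isLeast_wirtingerConst {k : ℕ} (hk : 0 < k) :
    IsLeast (wirtingerSet k) (wirtingerConst k) := by
  obtain ⟨ε, hε, hlb⟩ := wirtingerSet_lower_bound hk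
  have hne : (wirtingerSet k).Nonempty := ⟨1, one_mem_wirtingerSet k⟩
  refine ⟨⟨hε.trans_le (le_csInf hne hlb), fun a b hab D hD hbc => ?_⟩,
    fun c hc => csInf_le ⟨ε, hlb⟩ hc⟩
  have hcont : Continuous fun c : ℝ =>
      c ^ (2 * k) * (b - a) ^ (2 * k) * ∫ t in a..b, ‖D k t‖ ^ 2 := by fun_prop
  have hcl : wirtingerConst k ∈ closure (wirtingerSet k) := csInf_mem_closure hne ⟨ε, hlb⟩
  have hclosed := isClosed_le (continuous_const (y := ∫ t in a..b, ‖D 0 t‖ ^ 2)) hcont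
  exact closure_minimal (fun c hc => hc.2 a b hab D hD hbc) hclosed hcl

/-! ### Bandlimited functions -/

/-- The space `B(Ω)` of `Ω`-bandlimited functions, as a subspace of `L²(ℝ)`. The angular-frequency
transform `∫ f(t) exp(-i w t) dt` at `w = 2πξ` is the value of Mathlib's `𝓕 f` at `ξ`. -/
def bandlimited (Ω : Set ℝ) : Submodule ℂ (Lp ℂ 2 (volume : Measure ℝ)) where
  carrier := {f | ∀ᵐ ξ : ℝ, 2 * Real.pi * ξ ∉ Ω →
    (𝓕 f : Lp ℂ 2 (volume : Measure ℝ)) ξ = 0}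
  zero_mem' := by
    have h : (𝓕 (0 : Lp ℂ 2 (volume : Measure ℝ)) : Lp ℂ 2 (volume : Measure ℝ)) = 0 :=
      (Lp.fourierTransformₗᵢ ℝ ℂ).map_zero
    simp only [mem_ofPred_eq, h]
    filter_upwards [Lp.coeFn_zero ℂ 2 (volume : Measure ℝ)] with ξ hξ _
    rw [hξ, Pi.zero_apply]
  add_mem' := by
    intro f g hf hg
    have h : (𝓕 (f + g) : Lp ℂ 2 (volume : Measure ℝ)) = 𝓕 f + 𝓕 g :=
      (Lp.fourierTransformₗᵢ ℝ ℂ).map_add f g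
    simp only [mem_ofPred_eq, h] at hf hg ⊢
    filter_upwards [Lp.coeFn_add (𝓕 f : Lp ℂ 2 (volume : Measure ℝ)) (𝓕 g), hf, hg]
      with ξ hξ hf hg hΩ
    rw [hξ, Pi.add_apply, hf hΩ, hg hΩ, add_zero]
  smul_mem' := by
    intro c f hf
    have h : (𝓕 (c • f) : Lp ℂ 2 (volume : Measure ℝ)) = c • 𝓕 f :=
      (Lp.fourierTransformₗᵢ ℝ ℂ).map_smul c f
    simp only [mem_ofPred_eq, h] at hf ⊢
    filter_upwards [Lp.coeFn_smul c (𝓕 f : Lp ℂ 2 (volume : Measure ℝ)), hf] with ξ hξ hf hΩ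
    rw [hξ, Pi.smul_apply, hf hΩ, smul_zero]

/-- `m_Ω`, the supremum of `|w|` over `w ∈ Ω`. -/
def bandwidth (Ω : Set ℝ) : ℝ := sSup ((fun w : ℝ => |w|) '' Ω)

/-- `Φ_Ω(t) = (2π)⁻¹ ∫_Ω exp(i w t) dw`. -/
def bandKernel (Ω : Set ℝ) (t : ℝ) : ℂ :=
  (1 / (2 * Real.pi) : ℝ) * ∫ w in Ω, Complex.exp (Complex.I * w * t)

/-! ### Sampling points -/

/-- `δ = sup_t inf_n |t - x_n|`, with the value `∞` if the distances are unbounded. -/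
def samplingDensity (x : ℤ → ℝ) : ℝ≥0∞ := ⨆ t : ℝ, ⨅ n : ℤ, ENNReal.ofReal |t - x n|

/-- The Voronoi cell `V_n` of the sampling point `x n`. -/
def voronoiCell (x : ℤ → ℝ) (n : ℤ) : Set ℝ := {t | ∀ m : ℤ, m ≠ n → |t - x n| ≤ |t - x m|}

/-- The weights `μ_{n,l}`. -/
def samplingWeight (x : ℤ → ℝ) (n : ℤ) (l : ℕ) : ℝ :=
  1 / (l.factorial : ℝ) * ∫ t in voronoiCell x n, (t - x n) ^ (2 * l)

/-- The inequality `A ‖f‖² ≤ ∑_n ∑_{l ≤ k} μ_{n,l} |f^(l)(x_n)|² ≤ B ‖f‖²` for all `f ∈ B(Ω)`, where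
the series converges and `f` is evaluated through its (unique) smooth representative `F`. -/
def SamplingInequality (Ω : Set ℝ) (x : ℤ → ℝ) (k : ℕ) (A B : ℝ) : Prop :=
  ∀ f ∈ bandlimited Ω, ∃ F : ℝ → ℂ, ContDiff ℝ ∞ F ∧ f =ᵐ[volume] F ∧
    Summable (fun n : ℤ =>
      ∑ l ∈ Finset.range (k + 1), samplingWeight x n l * ‖iteratedDeriv l F (x n)‖ ^ 2) ∧
    A * ‖f‖ ^ 2 ≤ ∑' n : ℤ,
      ∑ l ∈ Finset.range (k + 1), samplingWeight x n l * ‖iteratedDeriv l F (x n)‖ ^ 2 ∧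
    ∑' n : ℤ, ∑ l ∈ Finset.range (k + 1),
      samplingWeight x n l * ‖iteratedDeriv l F (x n)‖ ^ 2 ≤ B * ‖f‖ ^ 2

/-- The family `φ` is a frame for `H` with frame bounds `A, B > 0`. -/
structure IsFrameWithBounds {ι H : Type*} [NormedAddCommGroup H] [InnerProductSpace ℂ H]
    (φ : ι → H) (A B : ℝ) : Prop where
  lower_pos : 0 < A
  upper_pos : 0 < B
  summable : ∀ f : H, Summable fun i => ‖inner ℂ (φ i) f‖ ^ 2
  lower : ∀ f : H, A * ‖f‖ ^ 2 ≤ ∑' i, ‖inner ℂ (φ i) f‖ ^ 2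
  upper : ∀ f : H, ∑' i, ‖inner ℂ (φ i) f‖ ^ 2 ≤ B * ‖f‖ ^ 2

end

/-! ### The inverse Fourier transform of square integrable functions of bounded support -/

/-! On the cell of `x n`, compare `f` with its Taylor polynomial `T` of degree `k` at `x n`. The
sample cuts the cell into two pieces of length at most `δ`, and `f - T` vanishes to order `k + 1` at
their common endpoint. Wirtinger's inequality on each piece (`integral_cell_norm_sq_le_sampleTerm`),
summed over the cells, and Bernstein's inequality `‖f^(k+1)‖ ≤ m^(k+1) ‖f‖` show that the piecewise
polynomial lies within `(c δ m)^(k+1) ‖f‖` of `f`. Cauchy–Schwarz with weights `1 / l!` bounds its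
squared norm by `e` times the sampling sum (`norm_sq_taylorSum_le`), whence the lower bound.

For the upper bound, replace each `f^(l)` by the step function with values `f^(l)(x n)`. The
first-order Wirtinger inequality with constant `2 / π` bounds its norm by `(1 + 2 δ m / π) m^l ‖f‖`,
and the weights are at most `δ^(2l) / l!` times the cell length; summing over `l` gives the
exponential.

By Parseval, the inner product of `f` with the `l`-th derivative of the translated kernel is `(-1)^l
f^(l)(x n)` (`inner_frameLp`), so the sampling inequality and the frame inequality are the same
statement. -/

theorem integral_fourierInv_mul_eq {f g : ℝ → ℂ} (hf : Integrable f) (hg : Integrable g) :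
    ∫ ξ, 𝓕⁻ f ξ * g ξ = ∫ t, f t * 𝓕⁻ g t := by
  -- The inverse transform is the Fourier integral of the negated inner product, a symmetric form,
  -- so Fubini moves it from one factor to the other.
  have h := VectorFourier.integral_fourierIntegral_smul_eq_flip (L := -innerₗ ℝ)
    (μ := volume) (ν := volume) Real.continuous_fourierChar
    ((continuous_inner (𝕜 := ℝ) (E := ℝ)).neg) hf hg
  have e : (-innerₗ ℝ : ℝ →ₗ[ℝ] ℝ →ₗ[ℝ] ℝ).flip = -innerₗ ℝ := by
    ext
    simp
  rwa [e] at h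

/-- On integrable functions, the inverse Fourier transform on `L²` is given by the integral. -/
theorem coeFn_fourierInv_ae_eq (g : Lp ℂ 2 (volume : Measure ℝ)) (hg : Integrable g) :
    ((𝓕⁻ g : Lp ℂ 2 (volume : Measure ℝ)) : ℝ → ℂ) =ᵐ[volume] 𝓕⁻ (g : ℝ → ℂ) := by
  have hc : Continuous (𝓕⁻ (g : ℝ → ℂ)) := by
    have h : Continuous (𝓕 (g : ℝ → ℂ)) :=
      VectorFourier.fourierIntegral_continuous Real.continuous_fourierChar
        (by simpa using! (continuous_inner (𝕜 := ℝ) (E := ℝ))) hg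
    have e : 𝓕⁻ (g : ℝ → ℂ) = fun t => 𝓕 (g : ℝ → ℂ) (-t) :=
      funext fun t => Real.fourierInv_eq_fourier_neg _ t
    rw [e]
    exact h.comp continuous_neg
  -- Both sides are locally integrable, so testing against smooth compactly supported functions
  -- suffices. These are Schwartz, and the `L²` inverse transform agrees with the distributional
  -- one, which acts on the test function.
  refine ae_eq_of_integral_contDiff_smul_eq
    ((Lp.memLp (𝓕⁻ g : Lp ℂ 2 (volume : Measure ℝ))).locallyIntegrable one_le_two)
    hc.locallyIntegrable fun φ hφ hφc => ?_
  have hφc' : HasCompactSupport fun t => (φ t : ℂ) := hφc.comp_left (g := fun r : ℝ => (r : ℂ)) rfl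
  have hφ' : ContDiff ℝ ∞ fun t => (φ t : ℂ) := Complex.ofRealCLM.contDiff.comp hφ
  let S : SchwartzMap ℝ ℂ := hφc'.toSchwartzMap hφ'
  have hS : ∀ t, S t = φ t := fun t => rfl
  have h := DFunLike.congr_fun (Lp.fourierInv_toTemperedDistribution_eq g) S
  rw [TemperedDistribution.fourierInv_apply, Lp.toTemperedDistribution_apply,
    Lp.toTemperedDistribution_apply, SchwartzMap.fourierInv_coe] at h
  simp only [smul_eq_mul] at h
  rw [integral_fourierInv_mul_eq S.integrable hg] at h
  simp only [hS] at h
  simpa only [Complex.real_smul] using h.symm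

theorem MeasureTheory.Lp.integral_norm_sq_eq {α : Type*} [MeasurableSpace α]
    {μ : Measure α} (f : Lp ℂ 2 μ) : ∫ t, ‖f t‖ ^ 2 ∂μ = ‖f‖ ^ 2 := by
  have h := L2.inner_def (𝕜 := ℂ) f f
  simp only [inner_self_eq_norm_sq_to_K] at h
  have e : ∀ r : ℝ, ((r : ℂ)) ^ 2 = ((r ^ 2 : ℝ) : ℂ) := fun r => by push_cast; rfl
  simp only [RCLike.ofReal_eq_complex_ofReal, e, integral_complex_ofReal] at h
  exact_mod_cast h.symm

/-! ### Spectra of bounded support: smoothness, derivatives, Bernstein's inequality -/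

/-- `g` is square integrable and vanishes outside `[-R, R]`. -/
structure IsBoundedSpectrum (R : ℝ) (g : ℝ → ℂ) : Prop where
  memLp : MemLp g 2 volume
  ae_eq_zero : ∀ᵐ ξ : ℝ, R < |ξ| → g ξ = 0

namespace IsBoundedSpectrum

variable {R : ℝ} {g : ℝ → ℂ}

theorem integrable (hg : IsBoundedSpectrum R g) : Integrable g := by
  have h1 : IntegrableOn g (Icc (-R) R) := (hg.memLp.restrict _).integrable one_le_two
  refine (h1.integrable_indicator measurableSet_Icc).congr ?_
  filter_upwards [hg.ae_eq_zero] with ξ hξ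
  by_cases h : ξ ∈ Icc (-R) R
  · simp [h]
  · rw [indicator_of_notMem h, hξ]
    rw [mem_Icc, ← abs_le] at h
    exact not_le.1 h

theorem mul_of_bound (hg : IsBoundedSpectrum R g) {p : ℝ → ℂ} (hp : Measurable p) {C : ℝ}
    (hC : ∀ ξ, |ξ| ≤ R → ‖p ξ‖ ≤ C) : IsBoundedSpectrum R fun ξ => p ξ * g ξ := by
  refine ⟨hg.memLp.of_le_mul (c := C) (hp.aestronglyMeasurable.mul hg.memLp.1) ?_, ?_⟩
  · filter_upwards [hg.ae_eq_zero] with ξ hξ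
    by_cases h : R < |ξ|
    · simp [hξ h]
    · rw [norm_mul]
      exact mul_le_mul_of_nonneg_right (hC ξ (not_lt.1 h)) (norm_nonneg _)
  · filter_upwards [hg.ae_eq_zero] with ξ hξ h
    rw [hξ h, mul_zero]

theorem norm_pow_le {ξ : ℝ} (h : |ξ| ≤ R) (n : ℕ) :
    ‖(2 * Real.pi * Complex.I * ξ : ℂ) ^ n‖ ≤ (2 * Real.pi * R) ^ n := by
  rw [norm_pow]
  refine pow_le_pow_left₀ (norm_nonneg _) ?_ n
  simp only [Complex.norm_mul, Complex.norm_ofNat, Complex.norm_real, Complex.norm_I, mul_one,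
    Real.norm_eq_abs, abs_of_pos Real.pi_pos]
  gcongr

theorem pow_mul (hg : IsBoundedSpectrum R g) (n : ℕ) :
    IsBoundedSpectrum R fun ξ => (2 * Real.pi * Complex.I * ξ) ^ n * g ξ :=
  hg.mul_of_bound (by fun_prop) fun _ h => norm_pow_le h n

theorem integrable_pow_smul (hg : IsBoundedSpectrum R g) (n : ℕ) :
    Integrable fun ξ : ℝ => ξ ^ n • g ξ := by
  refine (hg.mul_of_bound (p := fun ξ : ℝ => ((ξ ^ n : ℝ) : ℂ)) (by fun_prop) (C := R ^ n)
    fun ξ h => ?_).integrable.congr (ae_of_all _ fun ξ => by simp)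
  rw [Complex.norm_real, norm_pow]
  exact pow_le_pow_left₀ (abs_nonneg _) h n

theorem contDiff_fourierInv (hg : IsBoundedSpectrum R g) : ContDiff ℝ ∞ (𝓕⁻ g) := by
  have e : 𝓕⁻ g = fun t => 𝓕 g (-t) := funext fun t => Real.fourierInv_eq_fourier_neg _ t
  rw [e]
  refine (Real.contDiff_fourier (N := ⊤) fun n _ => ?_).comp contDiff_neg
  exact (hg.integrable_pow_smul n).norm.congr (ae_of_all _ fun ξ => by simp)

/-- The inverse transform is the reflected forward transform; the sign `(-1)^n` from the reflection
cancels the one in the forward symbol `(-2πiξ)^n`. -/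
theorem iteratedDeriv_fourierInv (hg : IsBoundedSpectrum R g) (n : ℕ) :
    iteratedDeriv n (𝓕⁻ g) = 𝓕⁻ fun ξ : ℝ => (2 * Real.pi * Complex.I * ξ) ^ n * g ξ := by
  have e : 𝓕⁻ g = fun t => 𝓕 g (-t) := funext fun t => Real.fourierInv_eq_fourier_neg _ t
  ext t
  rw [e, iteratedDeriv_comp_neg, Real.iteratedDeriv_fourier (N := ⊤)
    (fun n _ => hg.integrable_pow_smul n) le_top, Real.fourierInv_eq_fourier_neg,
    Real.fourier_real_eq, Real.fourier_real_eq, ← integral_smul]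
  refine integral_congr_ae (ae_of_all _ fun ξ => ?_)
  simp only
  rw [smul_comm]
  congr 1
  rw [smul_eq_mul, Complex.real_smul, ← mul_assoc]
  congr 1
  push_cast
  rw [← mul_pow]
  ring

theorem fourierInv_toLp_ae_eq (hg : IsBoundedSpectrum R g) :
    ((𝓕⁻ (hg.memLp.toLp g) : Lp ℂ 2 (volume : Measure ℝ)) : ℝ → ℂ) =ᵐ[volume] 𝓕⁻ g := by
  have h := hg.memLp.coeFn_toLp
  refine (coeFn_fourierInv_ae_eq _ (hg.integrable.congr h.symm)).trans (ae_of_all _ fun t => ?_)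
  rw [Real.fourierInv_eq, Real.fourierInv_eq]
  refine integral_congr_ae ?_
  filter_upwards [h] with ξ hξ
  rw [hξ]

theorem memLp_fourierInv (hg : IsBoundedSpectrum R g) : MemLp (𝓕⁻ g) 2 volume :=
  (memLp_congr_ae hg.fourierInv_toLp_ae_eq).1 (Lp.memLp _)

theorem integral_norm_sq_fourierInv (hg : IsBoundedSpectrum R g) :
    ∫ t, ‖𝓕⁻ g t‖ ^ 2 = ∫ ξ, ‖g ξ‖ ^ 2 := by
  have h1 : ‖(𝓕⁻ (hg.memLp.toLp g) : Lp ℂ 2 (volume : Measure ℝ))‖ = ‖hg.memLp.toLp g‖ :=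
    (Lp.fourierTransformₗᵢ ℝ ℂ).symm.norm_map _
  have h2 := Lp.integral_norm_sq_eq (𝓕⁻ (hg.memLp.toLp g))
  rw [h1, ← Lp.integral_norm_sq_eq] at h2
  calc _ = _ := integral_congr_ae ?_
    _ = _ := h2
    _ = _ := integral_congr_ae ?_
  · filter_upwards [hg.fourierInv_toLp_ae_eq] with t ht
    rw [ht]
  · filter_upwards [hg.memLp.coeFn_toLp] with t ht
    rw [ht]

/-- Bernstein's inequality in `L²`. -/
theorem integral_norm_sq_iteratedDeriv_le (hg : IsBoundedSpectrum R g) (n : ℕ) :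
    ∫ t, ‖iteratedDeriv n (𝓕⁻ g) t‖ ^ 2 ≤ (2 * Real.pi * R) ^ (2 * n) * ∫ ξ, ‖g ξ‖ ^ 2 := by
  -- Plancherel moves the claim to the spectral side, where the symbol of the derivative is at most
  -- `(2πR)^n` on the support.
  rw [hg.iteratedDeriv_fourierInv, (hg.pow_mul n).integral_norm_sq_fourierInv,
    ← integral_const_mul]
  refine integral_mono_ae ((hg.pow_mul n).memLp.integrable_norm_pow two_ne_zero)
    ((hg.memLp.integrable_norm_pow two_ne_zero).const_mul _) ?_
  filter_upwards [hg.ae_eq_zero] with ξ hξ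
  by_cases h : R < |ξ|
  · simp [hξ h]
  · rw [norm_mul, mul_pow, mul_comm 2 n, _root_.pow_mul]
    refine mul_le_mul_of_nonneg_right (pow_le_pow_left₀ (norm_nonneg _) ?_ 2) (sq_nonneg _)
    exact norm_pow_le (not_lt.1 h) n

end IsBoundedSpectrum

/-! ### Wirtinger's inequality and Taylor remainders -/

/-- A Riccati argument: `w = r tan (r (e - t))` solves `w' = -(r² + w²)`, so expanding `‖f' - w f‖²
≥ 0` gives `(w ‖f‖²)' ≤ ‖f'‖² - r² ‖f‖²`. Integrating leaves no boundary terms. The bound on `r (b -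
a)` keeps the tangent away from its pole. -/
theorem sq_mul_integral_norm_sq_le {a b : ℝ} (hab : a < b) {f f' : ℝ → ℂ}
    (hf : ∀ t, HasDerivAt f (f' t) t) (hf' : Continuous f') (h0 : f a = 0 ∨ f b = 0)
    {r : ℝ} (hr : 0 ≤ r) (hrb : r * (b - a) < Real.pi / 2) :
    r ^ 2 * ∫ t in a..b, ‖f t‖ ^ 2 ≤ ∫ t in a..b, ‖f' t‖ ^ 2 := by
  have hfc : Continuous f := continuous_iff_continuousAt.2 fun t => (hf t).continuousAt
  -- `e` is the endpoint opposite to the prescribed zero of `f`: there `w` vanishes, and at the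
  -- other endpoint `f` does.
  obtain ⟨e, he, hbd⟩ : ∃ e ∈ Icc a b, ∀ t, t = a ∨ t = b → t = e ∨ f t = 0 := by
    rcases h0 with h | h
    · exact ⟨b, ⟨hab.le, le_rfl⟩, by rintro t (rfl | rfl) <;> simp [h]⟩
    · exact ⟨a, ⟨le_rfl, hab.le⟩, by rintro t (rfl | rfl) <;> simp [h]⟩
  set w : ℝ → ℝ := fun t => r * Real.tan (r * (e - t)) with hw
  have hcos : ∀ t ∈ Icc a b, 0 < Real.cos (r * (e - t)) := by
    intro t ht
    apply Real.cos_pos_of_mem_Ioo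
    have h1 : |e - t| ≤ b - a := abs_le.2 ⟨by linarith [he.1, ht.2], by linarith [he.2, ht.1]⟩
    have h2 : |r * (e - t)| < Real.pi / 2 := by
      rw [abs_mul, abs_of_nonneg hr]
      exact (mul_le_mul_of_nonneg_left h1 hr).trans_lt hrb
    exact abs_lt.1 h2
  have hwd : ∀ t ∈ Icc a b, HasDerivAt w (-(r ^ 2 + w t ^ 2)) t := by
    intro t ht
    have h1 : HasDerivAt (fun t => r * (e - t)) (-r) t := by
      simpa using ((hasDerivAt_id t).const_sub e).const_mul r
    have h2 := ((Real.hasDerivAt_tan (hcos t ht).ne').comp t h1).const_mul r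
    refine h2.congr_deriv ?_
    have h3 := Real.sin_sq_add_cos_sq (r * (e - t))
    have h4 := (hcos t ht).ne'
    simp only [hw, Real.tan_eq_sin_div_cos]
    field_simp
    linear_combination r ^ 2 * h3
  have hgd : ∀ t ∈ Icc a b, HasDerivAt (fun t => w t * ‖f t‖ ^ 2)
      (-(r ^ 2 + w t ^ 2) * ‖f t‖ ^ 2 + w t * (2 * inner ℝ (f t) (f' t))) t := fun t ht =>
    (hwd t ht).mul (hf t).norm_sq
  have hcont1 : Continuous fun t => ‖f' t‖ ^ 2 := by fun_prop
  have hcont2 : Continuous fun t => r ^ 2 * ‖f t‖ ^ 2 := by fun_prop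
  have key := intervalIntegral.sub_le_integral_of_hasDeriv_right_of_le hab.le
    (g := fun t => w t * ‖f t‖ ^ 2) (φ := fun t => ‖f' t‖ ^ 2 - r ^ 2 * ‖f t‖ ^ 2)
    (fun t ht => (hgd t ht).continuousAt.continuousWithinAt)
    (fun t ht => (hgd t (Ioo_subset_Icc_self ht)).hasDerivWithinAt)
    ((hcont1.sub hcont2).continuousOn.integrableOn_compact isCompact_Icc) (fun t _ => by
      have h := norm_sub_sq_real (f' t) (w t • f t)
      rw [inner_smul_right, norm_smul, real_inner_comm, mul_pow, Real.norm_eq_abs, sq_abs] at h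
      nlinarith [sq_nonneg ‖f' t - w t • f t‖])
  have hz : ∀ t, t = a ∨ t = b → w t * ‖f t‖ ^ 2 = 0 := by
    intro t ht
    rcases hbd t ht with h | h
    · simp [hw, h]
    · simp [h]
  rw [hz a (Or.inl rfl), hz b (Or.inr rfl), intervalIntegral.integral_sub
    (hcont1.intervalIntegrable _ _) (hcont2.intervalIntegrable _ _),
    intervalIntegral.integral_const_mul] at key
  linarith

/-- Wirtinger's inequality of first order, with its optimal constant `2 / π`. -/
theorem integral_norm_sq_le_of_eq_zero {a b : ℝ} (hab : a < b) {f f' : ℝ → ℂ}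
    (hf : ∀ t, HasDerivAt f (f' t) t) (hf' : Continuous f') (h0 : f a = 0 ∨ f b = 0) :
    ∫ t in a..b, ‖f t‖ ^ 2 ≤ (2 / Real.pi * (b - a)) ^ 2 * ∫ t in a..b, ‖f' t‖ ^ 2 := by
  have hba := sub_pos.2 hab
  set s := Real.pi / 2 / (b - a) with hs
  have hs0 : 0 < s := by positivity
  have h1 : s ^ 2 * (∫ t in a..b, ‖f t‖ ^ 2) ≤ ∫ t in a..b, ‖f' t‖ ^ 2 := by
    -- At `r = s` the tangent has a pole in the closed interval, so the sharp constant is reached as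
    -- a limit of smaller `r`.
    have hcl : s ∈ closure (Ico 0 s) := by
      rw [closure_Ico hs0.ne]
      exact ⟨hs0.le, le_rfl⟩
    refine closure_minimal (s := Ico 0 s)
      (t := {r | r ^ 2 * (∫ t in a..b, ‖f t‖ ^ 2) ≤ ∫ t in a..b, ‖f' t‖ ^ 2}) (fun r hr => ?_)
      (isClosed_le (by fun_prop) continuous_const) hcl
    exact sq_mul_integral_norm_sq_le hab hf hf' h0 hr.1 ((lt_div_iff₀ hba).1 hr.2)
  have h2 : (2 / Real.pi * (b - a)) ^ 2 * s ^ 2 = 1 := by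
    rw [hs]
    field_simp
  calc _ = (2 / Real.pi * (b - a)) ^ 2 * (s ^ 2 * ∫ t in a..b, ‖f t‖ ^ 2) := by
        rw [← mul_assoc, h2, one_mul]
    _ ≤ _ := mul_le_mul_of_nonneg_left h1 (sq_nonneg _)

/-- Integration by parts has no boundary terms because test functions vanish at `a` and `b`. This
makes the Sobolev Wirtinger constant available for smooth functions. -/
theorem isSobolevJet_of_hasDerivAt {k : ℕ} {a b : ℝ} {D : ℕ → ℝ → ℂ}
    (hD : ∀ j < k, ∀ t, HasDerivAt (D j) (D (j + 1) t) t) (hk : Continuous (D k)) :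
    IsSobolevJet k a b D := by
  have hcont : ∀ j ≤ k, Continuous (D j) := by
    intro j hj
    rcases hj.lt_or_eq with h | rfl
    · exact continuous_iff_continuousAt.2 fun t => (hD j h t).continuousAt
    · exact hk
  refine ⟨fun j hj => ?_, fun j hj => (hcont j hj.le).continuousOn, fun j hj φ hφ _ hs => ?_⟩
  · rw [memLp_two_iff_integrable_sq_norm (hcont j hj).aestronglyMeasurable]
    exact (((hcont j hj).norm.pow 2).continuousOn.integrableOn_compact isCompact_Icc).mono_set
      Ioo_subset_Icc_self
  · have h0 : φ a = 0 := image_eq_zero_of_notMem_tsupport fun h => by simpa using hs h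
    have h1 : φ b = 0 := image_eq_zero_of_notMem_tsupport fun h => by simpa using hs h
    rw [intervalIntegral.integral_smul_deriv_eq_deriv_smul (a := a) (b := b)
      (fun t _ => (hφ.differentiable (by simp) t).hasDerivAt) (fun t _ => hD j hj t)
      ((hφ.continuous_deriv (by simp)).intervalIntegrable _ _)
      ((hcont (j + 1) hj).intervalIntegrable _ _), h0, h1]
    simp

/-! ### Taylor polynomials and their remainders -/

/-- The polynomial of degree less than `n` with derivatives `c l` at `p`. -/
noncomputable def taylorSum (c : ℕ → ℂ) (n : ℕ) (p t : ℝ) : ℂ :=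
  ∑ l ∈ Finset.range n, ((t - p) ^ l / (l.factorial : ℝ)) • c l

theorem continuous_taylorSum (c : ℕ → ℂ) (n : ℕ) (p : ℝ) : Continuous (taylorSum c n p) := by
  unfold taylorSum
  fun_prop

theorem hasDerivAt_taylorSum (c : ℕ → ℂ) (n : ℕ) (p t : ℝ) :
    HasDerivAt (taylorSum c (n + 1) p) (taylorSum (fun l => c (l + 1)) n p t) t := by
  have h : HasDerivAt (taylorSum c (n + 1) p) (∑ l ∈ Finset.range (n + 1),
      ((l * (t - p) ^ (l - 1)) / (l.factorial : ℝ)) • c l) t := by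
    refine HasDerivAt.fun_sum fun l _ => HasDerivAt.smul_const (HasDerivAt.div_const ?_ _) _
    simpa using ((hasDerivAt_id t).sub_const p).fun_pow l
  rw [Finset.sum_range_succ'] at h
  simp only [Nat.cast_zero, zero_mul, zero_div, zero_smul, add_zero] at h
  convert h using 1
  refine Finset.sum_congr rfl fun l _ => ?_
  congr 1
  rw [Nat.factorial_succ]
  have h1 : (l.factorial : ℝ) ≠ 0 := by positivity
  have h2 : ((l : ℝ) + 1) ≠ 0 := by positivity
  rw [Nat.add_sub_cancel]
  push_cast
  field_simp

theorem taylorSum_self (c : ℕ → ℂ) (n : ℕ) (p : ℝ) : taylorSum c (n + 1) p p = c 0 := by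
  rw [taylorSum, Finset.sum_range_succ']
  simp

/-- Cauchy–Schwarz splits `1 / l!²` into two factors `1 / l!`: one sums to at most `e`, the source
of `e⁻¹` in the lower frame bound, and the other remains as the factor `1 / l!` of the sampling
weights. -/
theorem norm_sq_taylorSum_le (c : ℕ → ℂ) (n : ℕ) (p t : ℝ) :
    ‖taylorSum c n p t‖ ^ 2 ≤ Real.exp 1 *
      ∑ l ∈ Finset.range n, 1 / (l.factorial : ℝ) * (t - p) ^ (2 * l) * ‖c l‖ ^ 2 := by
  have h1 : ‖taylorSum c n p t‖ ≤
      ∑ l ∈ Finset.range n, |t - p| ^ l / (l.factorial : ℝ) * ‖c l‖ := by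
    refine (norm_sum_le _ _).trans (Finset.sum_le_sum fun l _ => ?_)
    rw [norm_smul, norm_div, norm_pow, Real.norm_eq_abs]
    simp
  have h2 := Finset.sum_sq_le_sum_mul_sum_of_sq_le_mul (Finset.range n)
    (r := fun l => |t - p| ^ l / (l.factorial : ℝ) * ‖c l‖)
    (f := fun l => 1 / (l.factorial : ℝ))
    (g := fun l => 1 / (l.factorial : ℝ) * (t - p) ^ (2 * l) * ‖c l‖ ^ 2)
    (fun l _ => by positivity)
    (fun l _ => mul_nonneg (mul_nonneg (by positivity) ((even_two_mul l).pow_nonneg _))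
      (by positivity))
    (fun l _ => le_of_eq <| by
      rw [mul_pow, div_pow, ← pow_mul, mul_comm l 2, pow_mul, sq_abs, ← pow_mul]
      ring)
  have h3 : ∑ l ∈ Finset.range n, 1 / (l.factorial : ℝ) ≤ Real.exp 1 := by
    simpa using Real.sum_le_exp_of_nonneg (x := 1) zero_le_one n
  calc _ ≤ _ := pow_le_pow_left₀ (norm_nonneg _) h1 2
    _ ≤ _ := h2
    _ ≤ _ := mul_le_mul_of_nonneg_right h3 (Finset.sum_nonneg fun l _ =>
      mul_nonneg (mul_nonneg (by positivity) ((even_two_mul l).pow_nonneg _)) (by positivity))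

theorem hasDerivAt_iteratedDeriv {F : ℝ → ℂ} (hF : ContDiff ℝ ∞ F) (n : ℕ) (t : ℝ) :
    HasDerivAt (iteratedDeriv n F) (iteratedDeriv (n + 1) F t) t := by
  rw [iteratedDeriv_succ]
  exact (hF.differentiable_iteratedDeriv n (by exact_mod_cast WithTop.coe_lt_top n) t).hasDerivAt

/-- The `L²` norm of the Taylor remainder at an endpoint of an interval. -/
theorem integral_norm_sq_sub_taylorSum_le {a b p : ℝ} (hab : a < b) (hp : p = a ∨ p = b)
    {F : ℝ → ℂ} (hF : ContDiff ℝ ∞ F) (k : ℕ) :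
    ∫ t in a..b, ‖F t - taylorSum (fun l => iteratedDeriv l F p) (k + 1) p t‖ ^ 2 ≤
      wirtingerConst (k + 1) ^ (2 * (k + 1)) * (b - a) ^ (2 * (k + 1)) *
        ∫ t in a..b, ‖iteratedDeriv (k + 1) F t‖ ^ 2 := by
  -- The jet of the remainder: each derivative shifts the coefficients and removes one term of the
  -- polynomial, so at `j = k + 1` the sum is empty, while for `j ≤ k` its constant term cancels the
  -- value at `p`.
  set D : ℕ → ℝ → ℂ := fun j t => iteratedDeriv j F t -
    taylorSum (fun l => iteratedDeriv (l + j) F p) (k + 1 - j) p t with hD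
  have hder : ∀ j < k + 1, ∀ t, HasDerivAt (D j) (D (j + 1) t) t := by
    intro j hj t
    refine (hasDerivAt_iteratedDeriv hF j t).sub ?_
    have e : k + 1 - j = (k + 1 - (j + 1)) + 1 := by omega
    rw [e]
    simpa only [add_assoc, add_comm 1 j] using
      hasDerivAt_taylorSum (fun l => iteratedDeriv (l + j) F p) (k + 1 - (j + 1)) p t
  have hDk : D (k + 1) = iteratedDeriv (k + 1) F := by
    funext t
    simp [hD, taylorSum]
  have hcont : Continuous (D (k + 1)) := by
    rw [hDk]
    exact hF.continuous_iteratedDeriv _ (by exact_mod_cast le_top)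
  have hzero : ∀ j < k + 1, D j p = 0 := by
    intro j hj
    have e : k + 1 - j = (k - j) + 1 := by omega
    simp only [hD]
    rw [e, taylorSum_self, Nat.zero_add, sub_self]
  have h := (isLeast_wirtingerConst k.succ_pos).1.2 a b hab D
    (isSobolevJet_of_hasDerivAt hder hcont)
    (hp.imp (fun h j hj => by rw [← h, hzero j hj]) fun h j hj => by rw [← h, hzero j hj])
  rw [Nat.succ_eq_add_one, hDk] at h
  simpa [hD] using h

/-! ### Voronoi cells -/

/-- The left endpoint of the Voronoi cell of `x n`. -/
noncomputable def cellEnd (x : ℤ → ℝ) (n : ℤ) : ℝ := (x n + x (n - 1)) / 2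

section Voronoi

variable {x : ℤ → ℝ}

theorem cellEnd_succ (x : ℤ → ℝ) (n : ℤ) : cellEnd x (n + 1) = (x (n + 1) + x n) / 2 := by
  rw [cellEnd, add_sub_cancel_right]

theorem cellEnd_lt (hx : StrictMono x) (n : ℤ) : cellEnd x n < x n := by
  have := hx (sub_one_lt n)
  rw [cellEnd]
  linarith

theorem lt_cellEnd_succ (hx : StrictMono x) (n : ℤ) : x n < cellEnd x (n + 1) := by
  have := hx (lt_add_one n)
  rw [cellEnd_succ]
  linarith

theorem cellEnd_lt_succ (hx : StrictMono x) (n : ℤ) : cellEnd x n < cellEnd x (n + 1) :=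
  (cellEnd_lt hx n).trans (lt_cellEnd_succ hx n)

theorem monotone_cellEnd (hx : StrictMono x) : Monotone (cellEnd x) :=
  monotone_int_of_le_succ fun n => (cellEnd_lt_succ hx n).le

theorem abs_sub_le_abs_sub_iff {t p q : ℝ} (h : p < q) : |t - p| ≤ |t - q| ↔ t ≤ (q + p) / 2 := by
  rw [← sq_le_sq]
  constructor
  · intro h1
    by_contra! h2
    nlinarith
  · intro h1
    nlinarith

theorem abs_sub_le_abs_sub_iff' {t p q : ℝ} (h : p < q) :
    |t - q| ≤ |t - p| ↔ (q + p) / 2 ≤ t := by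
  rw [← sq_le_sq]
  constructor
  · intro h1
    by_contra! h2
    nlinarith
  · intro h1
    nlinarith

/-- The two neighbours impose the strongest constraints, since the midpoint of `x n` and `x m` moves
outwards as `m` moves away from `n`. -/
theorem voronoiCell_eq_Icc (hx : StrictMono x) (n : ℤ) :
    voronoiCell x n = Icc (cellEnd x n) (cellEnd x (n + 1)) := by
  ext t
  rw [cellEnd_succ, cellEnd]
  constructor
  · intro h
    exact ⟨(abs_sub_le_abs_sub_iff' (hx (sub_one_lt n))).1 (h _ (by omega)),
      (abs_sub_le_abs_sub_iff (hx (lt_add_one n))).1 (h _ (by omega))⟩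
  · rintro ⟨h1, h2⟩ m hm
    rcases hm.lt_or_gt with h | h
    · have := hx.monotone (Int.le_sub_one_of_lt h)
      exact (abs_sub_le_abs_sub_iff' (hx h)).2 (by linarith)
    · have := hx.monotone (Int.add_one_le_of_lt h)
      exact (abs_sub_le_abs_sub_iff (hx h)).2 (by linarith)

theorem samplingWeight_eq_intervalIntegral (hx : StrictMono x) (n : ℤ) (l : ℕ) :
    samplingWeight x n l = 1 / (l.factorial : ℝ) *
      ∫ t in cellEnd x n..cellEnd x (n + 1), (t - x n) ^ (2 * l) := by
  rw [samplingWeight, voronoiCell_eq_Icc hx, integral_Icc_eq_integral_Ioc,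
    intervalIntegral.integral_of_le (cellEnd_lt_succ hx n).le]

theorem samplingWeight_nonneg (x : ℤ → ℝ) (n : ℤ) (l : ℕ) : 0 ≤ samplingWeight x n l :=
  mul_nonneg (by positivity) (integral_nonneg fun t => (even_two_mul l).pow_nonneg _)

theorem samplingWeight_eq (hx : StrictMono x) (n : ℤ) (l : ℕ) :
    samplingWeight x n l = ((cellEnd x (n + 1) - x n) ^ (2 * l + 1) -
      (cellEnd x n - x n) ^ (2 * l + 1)) / ((l.factorial : ℝ) * (2 * l + 1)) := by
  rw [samplingWeight_eq_intervalIntegral hx,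
    intervalIntegral.integral_comp_sub_right (fun t => t ^ (2 * l)), integral_pow]
  push_cast
  rw [div_mul_div_comm, one_mul]

/-- The supremum is tested at the midpoint of two consecutive samples, which lies in the cell of `x
n` and so has distance exactly half the gap to the nearest sample. -/
theorem half_gap_le (hx : StrictMono x) (hfin : samplingDensity x ≠ ⊤) (n : ℤ) :
    (x (n + 1) - x n) / 2 ≤ (samplingDensity x).toReal := by
  refine (ENNReal.ofReal_le_iff_le_toReal hfin).1 (le_trans ?_ (le_iSup _ (cellEnd x (n + 1))))
  have hmem : cellEnd x (n + 1) ∈ voronoiCell x n := by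
    rw [voronoiCell_eq_Icc hx]
    exact ⟨(cellEnd_lt_succ hx n).le, le_rfl⟩
  have he : (x (n + 1) - x n) / 2 = |cellEnd x (n + 1) - x n| := by
    rw [abs_of_pos (sub_pos.2 (lt_cellEnd_succ hx n)), cellEnd_succ]
    ring
  rw [he]
  refine le_iInf fun m => ENNReal.ofReal_le_ofReal ?_
  rcases eq_or_ne m n with rfl | h
  · exact le_rfl
  · exact hmem m h

theorem sub_cellEnd_le (hx : StrictMono x) (hfin : samplingDensity x ≠ ⊤) (n : ℤ) :
    x n - cellEnd x n ≤ (samplingDensity x).toReal := by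
  have h := half_gap_le hx hfin (n - 1)
  rw [sub_add_cancel] at h
  rw [cellEnd]
  linarith

theorem cellEnd_succ_sub_le (hx : StrictMono x) (hfin : samplingDensity x ≠ ⊤) (n : ℤ) :
    cellEnd x (n + 1) - x n ≤ (samplingDensity x).toReal := by
  have h := half_gap_le hx hfin n
  rw [cellEnd_succ]
  linarith

/-- The added `1` gives a strict bound, so no infimum needs to be attained. -/
theorem exists_abs_sub_lt (hfin : samplingDensity x ≠ ⊤) (t : ℝ) :
    ∃ n, |t - x n| < (samplingDensity x).toReal + 1 := by
  have h : ⨅ n : ℤ, ENNReal.ofReal |t - x n| <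
      ENNReal.ofReal ((samplingDensity x).toReal + 1) := by
    refine (le_iSup (fun t => ⨅ n : ℤ, ENNReal.ofReal |t - x n|) t).trans_lt ?_
    exact (ENNReal.lt_ofReal_iff_toReal_lt hfin).2 (lt_add_one _)
  obtain ⟨n, hn⟩ := iInf_lt_iff.1 h
  exact ⟨n, (ENNReal.ofReal_lt_ofReal_iff (by positivity)).1 hn⟩

theorem iUnion_Ioc_cellEnd (hx : StrictMono x) (hfin : samplingDensity x ≠ ⊤) :
    ⋃ n : ℤ, Ioc (cellEnd x n) (cellEnd x (n + 1)) = univ := by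
  refine eq_univ_of_forall fun t => mem_iUnion.2 ?_
  set d := (samplingDensity x).toReal + 1 with hd
  -- Samples within `d` of `t - d` and of `t + d` lie to the left and right of `t`. Hence there is a
  -- last cell whose left end is below `t`; half-open cells make the cover disjoint.
  obtain ⟨p, hp⟩ := exists_abs_sub_lt hfin (t - d)
  obtain ⟨q, hq⟩ := exists_abs_sub_lt hfin (t + d)
  rw [abs_lt] at hp hq
  have h1 : cellEnd x p < t := (cellEnd_lt hx p).trans (by linarith [hp.1])
  have h2 : t ≤ cellEnd x (q + 1) := by linarith [lt_cellEnd_succ hx q, hq.2]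
  obtain ⟨n, hn, hmax⟩ := Int.exists_greatest_of_bdd (P := fun n => cellEnd x n < t)
    ⟨q + 1, fun m hm => by
      by_contra! h
      exact absurd (h2.trans (monotone_cellEnd hx h.le)) (not_le.2 hm)⟩ ⟨p, h1⟩
  refine ⟨n, hn, ?_⟩
  by_contra! h
  have := hmax _ h
  omega

theorem hasSum_integral_cell (hx : StrictMono x) (hfin : samplingDensity x ≠ ⊤) {h : ℝ → ℝ}
    (hh : Integrable h) :
    HasSum (fun n : ℤ => ∫ t in cellEnd x n..cellEnd x (n + 1), h t) (∫ t, h t) := by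
  have h1 := hasSum_integral_iUnion (s := fun n : ℤ => Ioc (cellEnd x n) (cellEnd x (n + 1)))
    (fun n => measurableSet_Ioc)
    (by simpa [Order.succ_eq_add_one] using (monotone_cellEnd hx).pairwise_disjoint_on_Ioc_succ)
    (f := h) (μ := volume) hh.integrableOn
  rw [iUnion_Ioc_cellEnd hx hfin, setIntegral_univ] at h1
  simpa only [intervalIntegral.integral_of_le (cellEnd_lt_succ hx _).le] using h1

end Voronoi

/-! ### The sampling inequality -/

/-- A substitute for Minkowski's inequality that is linear in the squared norms, so it can be
integrated over cells and summed; `s` is optimised only after summation. -/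
theorem norm_add_sq_le_of_pos {E : Type*} [SeminormedAddCommGroup E] (u v : E) {s : ℝ}
    (hs : 0 < s) : ‖u + v‖ ^ 2 ≤ (1 + s) * ‖u‖ ^ 2 + (1 + s⁻¹) * ‖v‖ ^ 2 := by
  have h1 : ‖u + v‖ ^ 2 ≤ (‖u‖ + ‖v‖) ^ 2 := pow_le_pow_left₀ (norm_nonneg _) (norm_add_le u v) 2
  have h2 : (1 + s) * ‖u‖ ^ 2 + (1 + s⁻¹) * ‖v‖ ^ 2 - (‖u‖ + ‖v‖) ^ 2 =
      s⁻¹ * (s * ‖u‖ - ‖v‖) ^ 2 := by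
    field_simp
    ring
  have h3 : 0 ≤ s⁻¹ * (s * ‖u‖ - ‖v‖) ^ 2 := by positivity
  linarith

/-- For positive `p` and `q` the right-hand side is minimal at `s = q / p`, with value `(p + q)²`.
Shifting both by `ε` keeps this choice admissible when one of them vanishes. -/
theorem le_add_sq_of_forall_pos {y p q : ℝ} (hp : 0 ≤ p) (hq : 0 ≤ q)
    (h : ∀ s > 0, y ≤ (1 + s) * p ^ 2 + (1 + s⁻¹) * q ^ 2) : y ≤ (p + q) ^ 2 := by
  have key : ∀ ε > 0, y ≤ ((p + ε) + (q + ε)) ^ 2 := by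
    intro ε hε
    have hp' : 0 < p + ε := by positivity
    have hq' : 0 < q + ε := by positivity
    calc y ≤ _ := h ((q + ε) / (p + ε)) (by positivity)
      _ ≤ (1 + (q + ε) / (p + ε)) * (p + ε) ^ 2 +
          (1 + ((q + ε) / (p + ε))⁻¹) * (q + ε) ^ 2 := by
        gcongr <;> linarith
      _ = _ := by
        field_simp
        ring
  have hcl : (0 : ℝ) ∈ closure (Ioi 0) := by simp
  simpa using closure_minimal (s := Ioi (0 : ℝ)) (t := {ε | y ≤ ((p + ε) + (q + ε)) ^ 2}) key
    (isClosed_le continuous_const (by fun_prop)) hcl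

section Cell

variable {x : ℤ → ℝ}

/-- Wirtinger's inequality needs the zero at an endpoint, so each cell is cut at its sample; the
pieces then have length at most `δ` rather than `2 δ`. -/
theorem integral_cell_le (n : ℤ) {u v : ℝ → ℝ} (hu : Continuous u)
    (hv : Continuous v) (C : ℝ)
    (h1 : ∫ t in cellEnd x n..x n, u t ≤ C * ∫ t in cellEnd x n..x n, v t)
    (h2 : ∫ t in x n..cellEnd x (n + 1), u t ≤ C * ∫ t in x n..cellEnd x (n + 1), v t) :
    ∫ t in cellEnd x n..cellEnd x (n + 1), u t ≤
      C * ∫ t in cellEnd x n..cellEnd x (n + 1), v t := by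
  rw [← intervalIntegral.integral_add_adjacent_intervals (hu.intervalIntegrable _ _)
      (hu.intervalIntegrable (x n) _), ← intervalIntegral.integral_add_adjacent_intervals
      (hv.intervalIntegrable _ _) (hv.intervalIntegrable (x n) _), mul_add]
  exact add_le_add h1 h2

theorem integral_cell_norm_sq_le (hx : StrictMono x) (n : ℤ) {u v : ℝ → ℂ} (hu : Continuous u)
    (hv : Continuous v) {s : ℝ} (hs : 0 < s) :
    ∫ t in cellEnd x n..cellEnd x (n + 1), ‖u t‖ ^ 2 ≤
      (1 + s) * (∫ t in cellEnd x n..cellEnd x (n + 1), ‖v t‖ ^ 2) +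
        (1 + s⁻¹) * ∫ t in cellEnd x n..cellEnd x (n + 1), ‖u t - v t‖ ^ 2 := by
  have h1 : Continuous fun t => (1 + s) * ‖v t‖ ^ 2 := by fun_prop
  have h2 : Continuous fun t => (1 + s⁻¹) * ‖u t - v t‖ ^ 2 := by fun_prop
  rw [← intervalIntegral.integral_const_mul, ← intervalIntegral.integral_const_mul,
    ← intervalIntegral.integral_add (h1.intervalIntegrable _ _) (h2.intervalIntegrable _ _)]
  refine intervalIntegral.integral_mono_on (cellEnd_lt_succ hx n).le
    ((hu.norm.pow 2).intervalIntegrable _ _) ((h1.add h2).intervalIntegrable _ _) fun t _ => ?_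
  simpa using norm_add_sq_le_of_pos (v t) (u t - v t) hs

/-- The left side is the squared norm of the constant `g (x n)` on the cell. Its difference from `g`
vanishes at `x n`, so the sharp first-order inequality applies and produces the `2 δ / π` of the
upper frame bound. -/
theorem cell_length_mul_norm_sq_le (hx : StrictMono x) (hfin : samplingDensity x ≠ ⊤) (n : ℤ)
    {g g' : ℝ → ℂ} (hg : ∀ t, HasDerivAt g (g' t) t) (hg' : Continuous g') {s : ℝ} (hs : 0 < s) :
    (cellEnd x (n + 1) - cellEnd x n) * ‖g (x n)‖ ^ 2 ≤
      (1 + s) * (∫ t in cellEnd x n..cellEnd x (n + 1), ‖g t‖ ^ 2) +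
        (1 + s⁻¹) * ((2 / Real.pi * (samplingDensity x).toReal) ^ 2 *
          ∫ t in cellEnd x n..cellEnd x (n + 1), ‖g' t‖ ^ 2) := by
  have hgc : Continuous g := continuous_iff_continuousAt.2 fun t => (hg t).continuousAt
  have h := integral_cell_norm_sq_le hx n (u := fun _ => g (x n)) continuous_const hgc hs
  rw [intervalIntegral.integral_const, smul_eq_mul] at h
  refine h.trans (add_le_add le_rfl (mul_le_mul_of_nonneg_left ?_ (by positivity)))
  have hd : ∀ t, HasDerivAt (fun t => g t - g (x n)) (g' t) t := fun t => (hg t).sub_const _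
  simp_rw [norm_sub_rev (g (x n))]
  have hnn : ∀ a b : ℝ, a < b → 0 ≤ ∫ t in a..b, ‖g' t‖ ^ 2 := fun a b hab =>
    intervalIntegral.integral_nonneg hab.le fun t _ => sq_nonneg _
  have hl := cellEnd_lt hx n
  have hr := lt_cellEnd_succ hx n
  refine integral_cell_le n (by fun_prop) (by fun_prop) _ ?_ ?_
  · refine (integral_norm_sq_le_of_eq_zero hl hd hg' (by simp)).trans
      (mul_le_mul_of_nonneg_right ?_ (hnn _ _ hl))
    have h0 := sub_pos.2 hl
    have := sub_cellEnd_le hx hfin n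
    gcongr
  · refine (integral_norm_sq_le_of_eq_zero hr hd hg' (by simp)).trans
      (mul_le_mul_of_nonneg_right ?_ (hnn _ _ hr))
    have h0 := sub_pos.2 hr
    have := cellEnd_succ_sub_le hx hfin n
    gcongr

/-- The contribution of the sampling point `x n` to the sampling sum. -/
noncomputable def sampleTerm (x : ℤ → ℝ) (k : ℕ) (F : ℝ → ℂ) (n : ℤ) : ℝ :=
  ∑ l ∈ Finset.range (k + 1), samplingWeight x n l * ‖iteratedDeriv l F (x n)‖ ^ 2

theorem sampleTerm_nonneg (x : ℤ → ℝ) (k : ℕ) (F : ℝ → ℂ) (n : ℤ) : 0 ≤ sampleTerm x k F n :=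
  Finset.sum_nonneg fun l _ => mul_nonneg (samplingWeight_nonneg x n l) (sq_nonneg _)

theorem integral_cell_norm_sq_taylorSum_le (hx : StrictMono x) (n : ℤ) (k : ℕ) (F : ℝ → ℂ) :
    ∫ t in cellEnd x n..cellEnd x (n + 1),
      ‖taylorSum (fun l => iteratedDeriv l F (x n)) (k + 1) (x n) t‖ ^ 2 ≤
        Real.exp 1 * sampleTerm x k F n := by
  calc _ ≤ ∫ t in cellEnd x n..cellEnd x (n + 1), Real.exp 1 * ∑ l ∈ Finset.range (k + 1),
          1 / (l.factorial : ℝ) * (t - x n) ^ (2 * l) * ‖iteratedDeriv l F (x n)‖ ^ 2 := by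
        refine intervalIntegral.integral_mono_on (cellEnd_lt_succ hx n).le
          (((continuous_taylorSum _ _ _).norm.pow 2).intervalIntegrable _ _)
          (Continuous.intervalIntegrable (by fun_prop) _ _) fun t _ => norm_sq_taylorSum_le _ _ _ _
    _ = _ := by
        rw [intervalIntegral.integral_const_mul, intervalIntegral.integral_finsetSum
          fun l _ => Continuous.intervalIntegrable (by fun_prop) _ _, sampleTerm]
        congr 1
        refine Finset.sum_congr rfl fun l _ => ?_
        rw [intervalIntegral.integral_mul_const, intervalIntegral.integral_const_mul,
          samplingWeight_eq_intervalIntegral hx]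

/-- `F` is split into its Taylor polynomial at `x n`, controlled by the samples, and a remainder to
which Wirtinger's inequality of order `k + 1` applies on both sides of `x n`. -/
theorem integral_cell_norm_sq_le_sampleTerm (hx : StrictMono x) (hfin : samplingDensity x ≠ ⊤)
    (n : ℤ) (k : ℕ) {F : ℝ → ℂ} (hF : ContDiff ℝ ∞ F) {s : ℝ} (hs : 0 < s) :
    ∫ t in cellEnd x n..cellEnd x (n + 1), ‖F t‖ ^ 2 ≤
      (1 + s) * (Real.exp 1 * sampleTerm x k F n) +
        (1 + s⁻¹) * ((wirtingerConst (k + 1) * (samplingDensity x).toReal) ^ (2 * (k + 1)) *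
          ∫ t in cellEnd x n..cellEnd x (n + 1), ‖iteratedDeriv (k + 1) F t‖ ^ 2) := by
  set T := taylorSum (fun l => iteratedDeriv l F (x n)) (k + 1) (x n) with hT
  have hTc : Continuous T := continuous_taylorSum _ _ _
  have hFc : Continuous F := hF.continuous
  have hDc : Continuous (iteratedDeriv (k + 1) F) :=
    hF.continuous_iteratedDeriv _ (by exact_mod_cast le_top)
  refine (integral_cell_norm_sq_le hx n hFc hTc hs).trans (add_le_add
    (mul_le_mul_of_nonneg_left (integral_cell_norm_sq_taylorSum_le hx n k F) (by positivity))
    (mul_le_mul_of_nonneg_left ?_ (by positivity)))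
  have hnn : ∀ a b : ℝ, a < b → 0 ≤ ∫ t in a..b, ‖iteratedDeriv (k + 1) F t‖ ^ 2 := fun a b hab =>
    intervalIntegral.integral_nonneg hab.le fun t _ => sq_nonneg _
  have hc : 0 < wirtingerConst (k + 1) := (isLeast_wirtingerConst k.succ_pos).1.1
  have hl := cellEnd_lt hx n
  have hr := lt_cellEnd_succ hx n
  refine integral_cell_le n (by fun_prop) (by fun_prop) _ ?_ ?_
  · refine (integral_norm_sq_sub_taylorSum_le hl (Or.inr rfl) hF k).trans
      (mul_le_mul_of_nonneg_right ?_ (hnn _ _ hl))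
    rw [mul_pow]
    have h0 := sub_pos.2 hl
    have := sub_cellEnd_le hx hfin n
    gcongr
  · refine (integral_norm_sq_sub_taylorSum_le hr (Or.inl rfl) hF k).trans
      (mul_le_mul_of_nonneg_right ?_ (hnn _ _ hr))
    rw [mul_pow]
    have h0 := sub_pos.2 hr
    have := cellEnd_succ_sub_le hx hfin n
    gcongr

theorem samplingWeight_le (hx : StrictMono x) (hfin : samplingDensity x ≠ ⊤) (n : ℤ) (l : ℕ) :
    samplingWeight x n l ≤ (samplingDensity x).toReal ^ (2 * l) / (l.factorial : ℝ) *
      (cellEnd x (n + 1) - cellEnd x n) := by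
  rw [samplingWeight_eq_intervalIntegral hx, one_div_mul_eq_div, div_mul_eq_mul_div]
  gcongr
  calc _ ≤ ∫ t in cellEnd x n..cellEnd x (n + 1), (samplingDensity x).toReal ^ (2 * l) := by
        refine intervalIntegral.integral_mono_on (cellEnd_lt_succ hx n).le
          (Continuous.intervalIntegrable (by fun_prop) _ _) intervalIntegrable_const fun t ht => ?_
        rw [← (even_two_mul l).pow_abs]
        refine pow_le_pow_left₀ (abs_nonneg _) (abs_le.2 ⟨?_, ?_⟩) _
        · linarith [sub_cellEnd_le hx hfin n, ht.1]
        · linarith [cellEnd_succ_sub_le hx hfin n, ht.2]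
    _ = _ := by
        rw [intervalIntegral.integral_const, smul_eq_mul, mul_comm]

end Cell

/-! ### Summation over the cells: the two global bounds -/

/-- `F` is smooth with square integrable derivatives satisfying Bernstein's inequality with
constant `m`. -/
structure IsBernstein (m : ℝ) (F : ℝ → ℂ) : Prop where
  nonneg : 0 ≤ m
  contDiff : ContDiff ℝ ∞ F
  memLp : ∀ l, MemLp (iteratedDeriv l F) 2 volume
  le : ∀ l, ∫ t, ‖iteratedDeriv l F t‖ ^ 2 ≤ m ^ (2 * l) * ∫ t, ‖F t‖ ^ 2

namespace IsBernstein

variable {m : ℝ} {F : ℝ → ℂ} {x : ℤ → ℝ}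

theorem hasSum_cell (hF : IsBernstein m F) (hx : StrictMono x) (hfin : samplingDensity x ≠ ⊤)
    (l : ℕ) : HasSum (fun n : ℤ => ∫ t in cellEnd x n..cellEnd x (n + 1), ‖iteratedDeriv l F t‖ ^ 2)
      (∫ t, ‖iteratedDeriv l F t‖ ^ 2) :=
  hasSum_integral_cell hx hfin ((hF.memLp l).integrable_norm_pow two_ne_zero)

theorem summable_cell_length_mul (hF : IsBernstein m F) (hx : StrictMono x)
    (hfin : samplingDensity x ≠ ⊤) (l : ℕ) :
    Summable (fun n : ℤ => (cellEnd x (n + 1) - cellEnd x n) * ‖iteratedDeriv l F (x n)‖ ^ 2) ∧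
      ∑' n : ℤ, (cellEnd x (n + 1) - cellEnd x n) * ‖iteratedDeriv l F (x n)‖ ^ 2 ≤
        (1 + 2 * (samplingDensity x).toReal * m / Real.pi) ^ 2 *
          (m ^ (2 * l) * ∫ t, ‖F t‖ ^ 2) := by
  set d := (samplingDensity x).toReal with hd
  have hd0 : 0 ≤ d := ENNReal.toReal_nonneg
  have hm := hF.nonneg
  set N := ∫ t, ‖F t‖ ^ 2 with hN
  have hN0 : 0 ≤ N := integral_nonneg fun t => sq_nonneg _
  have hcell : ∀ s > 0, ∀ n, (cellEnd x (n + 1) - cellEnd x n) * ‖iteratedDeriv l F (x n)‖ ^ 2 ≤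
      (1 + s) * (∫ t in cellEnd x n..cellEnd x (n + 1), ‖iteratedDeriv l F t‖ ^ 2) +
        (1 + s⁻¹) * ((2 / Real.pi * d) ^ 2 *
          ∫ t in cellEnd x n..cellEnd x (n + 1), ‖iteratedDeriv (l + 1) F t‖ ^ 2) :=
    fun s hs n => cell_length_mul_norm_sq_le hx hfin n (hasDerivAt_iteratedDeriv hF.contDiff l)
      (hF.contDiff.continuous_iteratedDeriv _ (by exact_mod_cast le_top)) hs
  have hsum : ∀ s : ℝ, _ := fun s => ((hF.hasSum_cell hx hfin l).mul_left (1 + s)).add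
    (((hF.hasSum_cell hx hfin (l + 1)).mul_left ((2 / Real.pi * d) ^ 2)).mul_left (1 + s⁻¹))
  have hnn : ∀ n, 0 ≤ (cellEnd x (n + 1) - cellEnd x n) * ‖iteratedDeriv l F (x n)‖ ^ 2 :=
    fun n => mul_nonneg (sub_pos.2 (cellEnd_lt_succ hx n)).le (sq_nonneg _)
  have hS : Summable
      fun n : ℤ => (cellEnd x (n + 1) - cellEnd x n) * ‖iteratedDeriv l F (x n)‖ ^ 2 :=
    -- Any `s` gives convergence; the optimal one matters only for the constant.
    Summable.of_nonneg_of_le hnn (hcell 1 one_pos) (hsum 1).summable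
  refine ⟨hS, ?_⟩
  have hsq : ∀ j, (m ^ j * √N) ^ 2 = m ^ (2 * j) * N := fun j => by
    rw [mul_pow, Real.sq_sqrt hN0, ← pow_mul, mul_comm j 2]
  -- `p` is Bernstein's bound for the norm of the `l`-th derivative, and `q` bounds the distance
  -- from it to its step function.
  have h := le_add_sq_of_forall_pos (y := ∑' n : ℤ,
    (cellEnd x (n + 1) - cellEnd x n) * ‖iteratedDeriv l F (x n)‖ ^ 2)
    (p := m ^ l * √N) (q := 2 / Real.pi * d * (m ^ (l + 1) * √N)) (by positivity) (by positivity)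
    fun s hs => by
      refine (hasSum_le (hcell s hs) hS.hasSum (hsum s)).trans ?_
      rw [hsq, mul_pow (2 / Real.pi * d) (m ^ _ * √N), hsq]
      gcongr
      · exact hF.le l
      · exact hF.le (l + 1)
  refine h.trans (le_of_eq ?_)
  have e : m ^ l * √N + 2 / Real.pi * d * (m ^ (l + 1) * √N) =
      (1 + 2 * d * m / Real.pi) * (m ^ l * √N) := by
    ring
  rw [e, mul_pow, hsq]

/-- Bounding the weights by `δ^(2l) / l!` times the cell length reduces the sum to the step
functions of each order; the powers `m^(2l)` then complete a partial sum of `exp ((δ m)²)`. -/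
theorem sampling_upper (hF : IsBernstein m F) (hx : StrictMono x)
    (hfin : samplingDensity x ≠ ⊤) (k : ℕ) :
    Summable (sampleTerm x k F) ∧ ∑' n, sampleTerm x k F n ≤
      (1 + 2 * (samplingDensity x).toReal * m / Real.pi) ^ 2 *
        Real.exp (((samplingDensity x).toReal * m) ^ 2) * ∫ t, ‖F t‖ ^ 2 := by
  set d := (samplingDensity x).toReal with hd
  have hd0 : 0 ≤ d := ENNReal.toReal_nonneg
  have hN0 : 0 ≤ ∫ t, ‖F t‖ ^ 2 := integral_nonneg fun t => sq_nonneg _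
  have hsum := hasSum_sum (s := Finset.range (k + 1)) fun l _ =>
    ((hF.summable_cell_length_mul hx hfin l).1.hasSum.mul_left (d ^ (2 * l) / (l.factorial : ℝ)))
  have hle : ∀ n, sampleTerm x k F n ≤ ∑ l ∈ Finset.range (k + 1), d ^ (2 * l) /
      (l.factorial : ℝ) * ((cellEnd x (n + 1) - cellEnd x n) * ‖iteratedDeriv l F (x n)‖ ^ 2) := by
    refine fun n => Finset.sum_le_sum fun l _ => ?_
    rw [← mul_assoc]
    exact mul_le_mul_of_nonneg_right (samplingWeight_le hx hfin n l) (sq_nonneg _)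
  have hS := Summable.of_nonneg_of_le (sampleTerm_nonneg x k F) hle hsum.summable
  refine ⟨hS, (hasSum_le hle hS.hasSum hsum).trans ?_⟩
  calc _ ≤ ∑ l ∈ Finset.range (k + 1), d ^ (2 * l) / (l.factorial : ℝ) *
          ((1 + 2 * d * m / Real.pi) ^ 2 * (m ^ (2 * l) * ∫ t, ‖F t‖ ^ 2)) :=
        Finset.sum_le_sum fun l _ => mul_le_mul_of_nonneg_left
          (hF.summable_cell_length_mul hx hfin l).2 (by positivity)
    _ = (∑ l ∈ Finset.range (k + 1), ((d * m) ^ 2) ^ l / (l.factorial : ℝ)) *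
          ((1 + 2 * d * m / Real.pi) ^ 2 * ∫ t, ‖F t‖ ^ 2) := by
        rw [Finset.sum_mul]
        refine Finset.sum_congr rfl fun l _ => ?_
        rw [← pow_mul, mul_pow]
        ring
    _ ≤ Real.exp ((d * m) ^ 2) * ((1 + 2 * d * m / Real.pi) ^ 2 * ∫ t, ‖F t‖ ^ 2) := by
        gcongr
        exact Real.sum_le_exp_of_nonneg (sq_nonneg _) _
    _ = _ := by ring

/-- With `Y` the sampling sum and `α = (c δ m)^(k+1)`, the cell estimates sum to `‖F‖ ≤ √(e Y) + α
‖F‖`. The hypothesis gives `α ≤ 1`, which is needed to square `(1 - α) ‖F‖ ≤ √(e Y)`. -/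
theorem sampling_lower (hF : IsBernstein m F) (hx : StrictMono x)
    (hfin : samplingDensity x ≠ ⊤) (k : ℕ)
    (hsmall : wirtingerConst (k + 1) * (samplingDensity x).toReal * m ≤ 1) :
    Real.exp (-1) * (1 - (wirtingerConst (k + 1) * (samplingDensity x).toReal * m) ^ (k + 1)) ^ 2 *
      ∫ t, ‖F t‖ ^ 2 ≤ ∑' n, sampleTerm x k F n := by
  have hc : 0 < wirtingerConst (k + 1) := (isLeast_wirtingerConst k.succ_pos).1.1
  have hm := hF.nonneg
  set d := (samplingDensity x).toReal with hd
  have hd0 : 0 ≤ d := ENNReal.toReal_nonneg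
  set c := wirtingerConst (k + 1) with hcdef
  set N := ∫ t, ‖F t‖ ^ 2 with hN
  have hN0 : 0 ≤ N := integral_nonneg fun t => sq_nonneg _
  have hS := (hF.sampling_upper hx hfin k).1
  set Y := ∑' n, sampleTerm x k F n with hY
  have hY0 : 0 ≤ Y := tsum_nonneg (sampleTerm_nonneg x k F)
  have hsqN : √N ^ 2 = N := Real.sq_sqrt hN0
  have hsqY : √(Real.exp 1 * Y) ^ 2 = Real.exp 1 * Y := Real.sq_sqrt (by positivity)
  have h := le_add_sq_of_forall_pos (y := N) (p := √(Real.exp 1 * Y))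
    (q := (c * d * m) ^ (k + 1) * √N) (by positivity) (by positivity) fun s hs => by
      have h1 := hF.hasSum_cell hx hfin 0
      simp only [iteratedDeriv_zero] at h1
      refine (hasSum_le (fun n => integral_cell_norm_sq_le_sampleTerm hx hfin n k hF.contDiff hs)
        h1 (((hS.hasSum.mul_left (Real.exp 1)).mul_left (1 + s)).add
        (((hF.hasSum_cell hx hfin (k + 1)).mul_left ((c * d) ^ (2 * (k + 1)))).mul_left
          (1 + s⁻¹)))).trans ?_
      rw [hsqY, mul_pow ((c * d * m) ^ (k + 1)), hsqN, ← pow_mul, mul_comm (k + 1) 2,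
        mul_pow (c * d), mul_assoc ((c * d) ^ _)]
      gcongr
      exact hF.le (k + 1)
  set α := (c * d * m) ^ (k + 1) with hα
  have hα1 : α ≤ 1 := pow_le_one₀ (by positivity) hsmall
  have h2 : √N ≤ √(Real.exp 1 * Y) + α * √N := by
    refine (Real.sqrt_le_sqrt h).trans (le_of_eq (Real.sqrt_sq (by positivity)))
  have h3 : ((1 - α) * √N) ^ 2 ≤ √(Real.exp 1 * Y) ^ 2 :=
    pow_le_pow_left₀ (mul_nonneg (sub_nonneg.2 hα1) (Real.sqrt_nonneg _)) (by linarith) 2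
  rw [mul_pow, hsqN, hsqY] at h3
  calc _ = Real.exp (-1) * ((1 - α) ^ 2 * N) := by ring
    _ ≤ Real.exp (-1) * (Real.exp 1 * Y) := mul_le_mul_of_nonneg_left h3 (Real.exp_nonneg _)
    _ = Y := by rw [← mul_assoc, ← Real.exp_add]; simp

end IsBernstein

/-! ### Bandlimited functions and the associated frame -/

section Bandlimited

variable {Ω : Set ℝ}

theorem bandwidth_nonneg (Ω : Set ℝ) : 0 ≤ bandwidth Ω :=
  Real.sSup_nonneg (by rintro _ ⟨w, _, rfl⟩; exact abs_nonneg w)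

theorem abs_le_bandwidth (hΩ : IsCompact Ω) {w : ℝ} (hw : w ∈ Ω) : |w| ≤ bandwidth Ω :=
  le_csSup (hΩ.image continuous_abs).bddAbove ⟨w, hw, rfl⟩

theorem two_pi_mul_notMem (hΩ : IsCompact Ω) {ξ : ℝ} (h : bandwidth Ω / (2 * Real.pi) < |ξ|) :
    2 * Real.pi * ξ ∉ Ω := by
  intro hw
  have h1 := abs_le_bandwidth hΩ hw
  rw [abs_mul, abs_of_pos Real.two_pi_pos] at h1
  rw [div_lt_iff₀ Real.two_pi_pos] at h
  linarith

/-- Frequencies are rescaled by `w = 2πξ`, so the spectral radius is `m / (2π)` and the Bernstein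
constant `2πR` becomes `m`. -/
theorem isBoundedSpectrum_of_mem (hΩ : IsCompact Ω) {f : Lp ℂ 2 (volume : Measure ℝ)}
    (hf : f ∈ bandlimited Ω) : IsBoundedSpectrum (bandwidth Ω / (2 * Real.pi))
      (𝓕 f : Lp ℂ 2 (volume : Measure ℝ)) := by
  refine ⟨Lp.memLp _, ?_⟩
  filter_upwards [show ∀ᵐ ξ : ℝ, _ from hf] with ξ hξ h
  exact hξ (two_pi_mul_notMem hΩ h)

/-- The smooth representative of a bandlimited function. -/
noncomputable def smoothRep (f : Lp ℂ 2 (volume : Measure ℝ)) : ℝ → ℂ :=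
  𝓕⁻ ((𝓕 f : Lp ℂ 2 (volume : Measure ℝ)) : ℝ → ℂ)

theorem ae_eq_smoothRep (hΩ : IsCompact Ω) {f : Lp ℂ 2 (volume : Measure ℝ)}
    (hf : f ∈ bandlimited Ω) : f =ᵐ[volume] smoothRep f := by
  have h := coeFn_fourierInv_ae_eq (𝓕 f) (isBoundedSpectrum_of_mem hΩ hf).integrable
  have e : (𝓕⁻ (𝓕 f : Lp ℂ 2 (volume : Measure ℝ)) : Lp ℂ 2 (volume : Measure ℝ)) = f :=
    (Lp.fourierTransformₗᵢ ℝ ℂ).symm_apply_apply f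
  rwa [e] at h

theorem integral_norm_sq_smoothRep (hΩ : IsCompact Ω) {f : Lp ℂ 2 (volume : Measure ℝ)}
    (hf : f ∈ bandlimited Ω) : ∫ t, ‖smoothRep f t‖ ^ 2 = ‖f‖ ^ 2 := by
  rw [← Lp.integral_norm_sq_eq]
  refine integral_congr_ae ?_
  filter_upwards [ae_eq_smoothRep hΩ hf] with t ht
  rw [ht]

theorem isBernstein_smoothRep (hΩ : IsCompact Ω) {f : Lp ℂ 2 (volume : Measure ℝ)}
    (hf : f ∈ bandlimited Ω) : IsBernstein (bandwidth Ω) (smoothRep f) := by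
  have hg := isBoundedSpectrum_of_mem hΩ hf
  refine ⟨bandwidth_nonneg Ω, hg.contDiff_fourierInv, fun l => ?_, fun l => ?_⟩
  · rw [smoothRep, hg.iteratedDeriv_fourierInv]
    exact (hg.pow_mul l).memLp_fourierInv
  · have h := hg.integral_norm_sq_iteratedDeriv_le l
    rwa [mul_div_cancel₀ _ Real.two_pi_pos.ne', ← hg.integral_norm_sq_fourierInv] at h

/-- Continuous functions that agree almost everywhere are equal, so the smooth representative is
forced to be `smoothRep f`. -/
theorem samplingInequality_iff (hΩ : IsCompact Ω) (x : ℤ → ℝ) (k : ℕ) (A B : ℝ) :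
    SamplingInequality Ω x k A B ↔ ∀ f ∈ bandlimited Ω, Summable (sampleTerm x k (smoothRep f)) ∧
      A * ‖f‖ ^ 2 ≤ ∑' n, sampleTerm x k (smoothRep f) n ∧
      ∑' n, sampleTerm x k (smoothRep f) n ≤ B * ‖f‖ ^ 2 := by
  refine forall₂_congr fun f hf => ?_
  have hF := (isBernstein_smoothRep hΩ hf).contDiff
  have hae := ae_eq_smoothRep hΩ hf
  constructor
  · rintro ⟨F, hFc, hfF, h⟩
    obtain rfl : F = smoothRep f :=
      (hFc.continuous.ae_eq_iff_eq volume hF.continuous).1 (hfF.symm.trans hae)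
    exact h
  · exact fun h => ⟨_, hF, hae, h⟩

/-! ### The frame functions and their Fourier transforms -/

/-- The Fourier transform of `bandKernel Ω (· - p)`. -/
noncomputable def bandSymbol (Ω : Set ℝ) (p ξ : ℝ) : ℂ :=
  Complex.exp (-(2 * Real.pi * Complex.I * ξ * p)) *
    ((2 * Real.pi * ·) ⁻¹' Ω).indicator (fun _ => 1) ξ

theorem measurableSet_preimage_two_pi (hΩ : IsCompact Ω) :
    MeasurableSet ((2 * Real.pi * ·) ⁻¹' Ω) :=
  hΩ.measurableSet.preimage (by fun_prop)

theorem isBoundedSpectrum_bandSymbol (hΩ : IsCompact Ω) (p : ℝ) :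
    IsBoundedSpectrum (bandwidth Ω / (2 * Real.pi)) (bandSymbol Ω p) := by
  set s : Set ℝ := (2 * Real.pi * ·) ⁻¹' Ω with hs
  have hsub : s ⊆ Icc (-(bandwidth Ω / (2 * Real.pi))) (bandwidth Ω / (2 * Real.pi)) := by
    intro ξ hξ
    rw [mem_Icc, ← abs_le]
    by_contra! h
    exact two_pi_mul_notMem hΩ h hξ
  have h : IsBoundedSpectrum (bandwidth Ω / (2 * Real.pi)) (s.indicator fun _ => (1 : ℂ)) := by
    refine ⟨memLp_indicator_const 2 (measurableSet_preimage_two_pi hΩ) 1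
      (Or.inr ((measure_mono hsub).trans_lt measure_Icc_lt_top).ne), ae_of_all _ fun ξ hξ => ?_⟩
    have h' : ξ ∉ s := two_pi_mul_notMem hΩ hξ
    exact indicator_of_notMem h' _
  refine h.mul_of_bound (p := fun ξ : ℝ => Complex.exp (-(2 * Real.pi * Complex.I * ξ * p)))
    (by fun_prop) (C := 1) fun ξ _ => ?_
  rw [Complex.norm_exp]
  simp

/-- The substitution `w = 2πξ` supplies the factor `1 / (2π)` of the kernel. -/
theorem fourierInv_bandSymbol (hΩ : IsCompact Ω) (p : ℝ) :
    𝓕⁻ (bandSymbol Ω p) = fun t => bandKernel Ω (t - p) := by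
  ext t
  set s : Set ℝ := (2 * Real.pi * ·) ⁻¹' Ω with hs
  have h1 : 𝓕⁻ (bandSymbol Ω p) t =
      ∫ ξ, Ω.indicator (fun w : ℝ => Complex.exp (Complex.I * w * (t - p : ℝ)))
        (2 * Real.pi * ξ) := by
    rw [Real.fourierInv_eq']
    refine integral_congr_ae (ae_of_all _ fun ξ => ?_)
    by_cases h : 2 * Real.pi * ξ ∈ Ω
    · have h' : ξ ∈ s := h
      simp only [bandSymbol, indicator_of_mem h, ← hs, indicator_of_mem h', smul_eq_mul, mul_one,
        ← Complex.exp_add]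
      congr 1
      simp only [RCLike.inner_apply, conj_trivial]
      push_cast
      ring
    · have h' : ξ ∉ s := h
      simp [bandSymbol, h, ← hs, h']
  rw [h1, Measure.integral_comp_mul_left (fun w => Ω.indicator
    (fun w : ℝ => Complex.exp (Complex.I * w * (t - p : ℝ))) w) (2 * Real.pi),
    integral_indicator hΩ.measurableSet, bandKernel, Complex.real_smul,
    abs_of_pos (inv_pos.2 Real.two_pi_pos), one_div]

/-- The frame functions, as elements of `L²`. -/
noncomputable def frameLp (hΩ : IsCompact Ω) (p : ℝ) (l : ℕ) : Lp ℂ 2 (volume : Measure ℝ) :=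
  𝓕⁻ (((isBoundedSpectrum_bandSymbol hΩ p).pow_mul l).memLp.toLp _)

theorem fourier_frameLp (hΩ : IsCompact Ω) (p : ℝ) (l : ℕ) :
    (𝓕 (frameLp hΩ p l) : Lp ℂ 2 (volume : Measure ℝ)) =
      ((isBoundedSpectrum_bandSymbol hΩ p).pow_mul l).memLp.toLp _ :=
  (Lp.fourierTransformₗᵢ ℝ ℂ).apply_symm_apply _

theorem frameLp_mem (hΩ : IsCompact Ω) (p : ℝ) (l : ℕ) : frameLp hΩ p l ∈ bandlimited Ω := by
  change ∀ᵐ ξ : ℝ, 2 * Real.pi * ξ ∉ Ω → (𝓕 (frameLp hΩ p l) : Lp ℂ 2 (volume : Measure ℝ)) ξ = 0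
  rw [fourier_frameLp]
  filter_upwards [((isBoundedSpectrum_bandSymbol hΩ p).pow_mul l).memLp.coeFn_toLp] with ξ hξ h
  have h' : ξ ∉ (2 * Real.pi * ·) ⁻¹' Ω := h
  rw [hξ, bandSymbol, indicator_of_notMem h', mul_zero, mul_zero]

theorem frameLp_ae_eq (hΩ : IsCompact Ω) (p : ℝ) (l : ℕ) :
    frameLp hΩ p l =ᵐ[volume] iteratedDeriv l fun t => bandKernel Ω (t - p) := by
  have hg := isBoundedSpectrum_bandSymbol hΩ p
  rw [← fourierInv_bandSymbol hΩ, hg.iteratedDeriv_fourierInv]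
  exact (hg.pow_mul l).fourierInv_toLp_ae_eq

/-- The reproducing property, by Parseval: conjugating the symbol turns `(2πiξ)^l exp (-2πiξp)` into
`(-1)^l (2πiξ)^l exp (2πiξp)`, and Fourier inversion of the `l`-th derivative of `f` at `p` appears.
Outside `Ω` the transform of `f` vanishes. -/
theorem inner_frameLp (hΩ : IsCompact Ω) (p : ℝ) (l : ℕ) {f : Lp ℂ 2 (volume : Measure ℝ)}
    (hf : f ∈ bandlimited Ω) :
    inner ℂ (frameLp hΩ p l) f = (-1) ^ l * iteratedDeriv l (smoothRep f) p := by
  rw [← Lp.inner_fourier_eq, fourier_frameLp, L2.inner_def, smoothRep,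
    (isBoundedSpectrum_of_mem hΩ hf).iteratedDeriv_fourierInv, Real.fourierInv_eq',
    ← integral_const_mul]
  refine integral_congr_ae ?_
  filter_upwards [((isBoundedSpectrum_bandSymbol hΩ p).pow_mul l).memLp.coeFn_toLp,
    show ∀ᵐ ξ : ℝ, _ from hf] with ξ hξ hz
  rw [hξ]
  by_cases h : 2 * Real.pi * ξ ∈ Ω
  · have h' : ξ ∈ (2 * Real.pi * ·) ⁻¹' Ω := h
    rw [bandSymbol, indicator_of_mem h']
    simp only [RCLike.inner_apply, map_mul, map_pow, ← Complex.exp_conj, map_neg, Complex.conj_I,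
      Complex.conj_ofReal, map_ofNat, mul_one, smul_eq_mul, conj_trivial]
    have e1 : (2 * (Real.pi : ℂ) * -Complex.I * ξ) ^ l =
        (-1) ^ l * (2 * (Real.pi : ℂ) * Complex.I * ξ) ^ l := by
      rw [← mul_pow]
      ring
    have e2 : -(2 * (Real.pi : ℂ) * -Complex.I * ξ * p) =
        ((2 * Real.pi * (p * ξ) : ℝ) : ℂ) * Complex.I := by
      push_cast
      ring
    rw [e1, e2]
    ring
  · rw [hz h]
    simp

/-- The frame functions, as elements of the space of bandlimited functions. -/
noncomputable def bandFrame (hΩ : IsCompact Ω) (x : ℤ → ℝ) (k : ℕ) (i : ℤ × Fin (k + 1)) :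
    bandlimited Ω :=
  (√(samplingWeight x i.1 i.2) : ℂ) • ⟨frameLp hΩ (x i.1) i.2, frameLp_mem hΩ _ _⟩

theorem norm_sq_inner_bandFrame (hΩ : IsCompact Ω) (x : ℤ → ℝ) (k : ℕ) (i : ℤ × Fin (k + 1))
    (f : bandlimited Ω) : ‖inner ℂ (bandFrame hΩ x k i) f‖ ^ 2 =
      samplingWeight x i.1 i.2 * ‖iteratedDeriv i.2 (smoothRep f) (x i.1)‖ ^ 2 := by
  rw [bandFrame, Submodule.coe_inner, Submodule.coe_smul, inner_smul_left, inner_frameLp hΩ _ _ f.2]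
  simp only [Complex.conj_ofReal, norm_mul, Complex.norm_real, norm_pow, norm_neg, norm_one,
    one_pow, one_mul, mul_pow, Real.norm_eq_abs, sq_abs]
  rw [Real.sq_sqrt (samplingWeight_nonneg x _ _)]

theorem tsum_inner_bandFrame (hΩ : IsCompact Ω) (x : ℤ → ℝ) (k : ℕ) (f : bandlimited Ω) (n : ℤ) :
    ∑' l : Fin (k + 1), ‖inner ℂ (bandFrame hΩ x k (n, l)) f‖ ^ 2 =
      sampleTerm x k (smoothRep f) n := by
  rw [tsum_fintype, sampleTerm, Finset.sum_range]
  exact Finset.sum_congr rfl fun l _ => norm_sq_inner_bandFrame hΩ x k (n, l) f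

/-- The terms are nonnegative and each sample contributes finitely many, so they may be grouped by
sample. -/
theorem summable_inner_bandFrame_iff (hΩ : IsCompact Ω) (x : ℤ → ℝ) (k : ℕ) (f : bandlimited Ω) :
    (Summable fun i => ‖inner ℂ (bandFrame hΩ x k i) f‖ ^ 2) ↔
      Summable (sampleTerm x k (smoothRep f)) := by
  rw [summable_prod_of_nonneg fun i => sq_nonneg _]
  simp only [tsum_inner_bandFrame]
  exact and_iff_right fun n => (hasSum_fintype _).summable

theorem isFrameWithBounds_bandFrame_iff (hΩ : IsCompact Ω) (x : ℤ → ℝ) (k : ℕ) {A B : ℝ}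
    (hA : 0 < A) (hB : 0 < B) :
    SamplingInequality Ω x k A B ↔ IsFrameWithBounds (bandFrame hΩ x k) A B := by
  rw [samplingInequality_iff hΩ]
  have key : ∀ f : bandlimited Ω, Summable (sampleTerm x k (smoothRep f)) →
      ∑' i, ‖inner ℂ (bandFrame hΩ x k i) f‖ ^ 2 = ∑' n, sampleTerm x k (smoothRep f) n := by
    intro f hf
    rw [((summable_inner_bandFrame_iff hΩ x k f).2 hf).tsum_prod]
    exact tsum_congr fun n => tsum_inner_bandFrame hΩ x k f n
  constructor
  · intro h
    refine ⟨hA, hB, fun f => (summable_inner_bandFrame_iff hΩ x k f).2 (h f f.2).1,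
      fun f => ?_, fun f => ?_⟩
    · rw [key f (h f f.2).1]
      exact (h f f.2).2.1
    · rw [key f (h f f.2).1]
      exact (h f f.2).2.2
  · intro h f hf
    have hs := (summable_inner_bandFrame_iff hΩ x k ⟨f, hf⟩).1 (h.summable ⟨f, hf⟩)
    exact ⟨hs, (h.lower ⟨f, hf⟩).trans_eq (key ⟨f, hf⟩ hs),
      (key ⟨f, hf⟩ hs).symm.trans_le (h.upper ⟨f, hf⟩)⟩

end Bandlimited

/-! ### The main theorem -/

/-- For `m = 0` the quotient in `ℝ≥0∞` is `⊤`, as intended, and the product is zero. -/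
theorem wirtingerConst_mul_lt_one {δ : ℝ≥0∞} {c m : ℝ} (hc : 0 < c) (hm : 0 ≤ m)
    (h : δ < ENNReal.ofReal (1 / c) / ENNReal.ofReal m) : c * δ.toReal * m < 1 := by
  rcases hm.eq_or_lt with rfl | hm
  · simp
  rw [← ENNReal.ofReal_div_of_pos hm, ENNReal.lt_ofReal_iff_toReal_lt h.ne_top,
    lt_div_iff₀ hm, lt_div_iff₀ hc] at h
  linarith

theorem theorem3p6 (Ω : Set ℝ) (hΩ : IsCompact Ω) (x : ℤ → ℝ) (hx : StrictMono x) (k : ℕ)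
    (hδ : samplingDensity x <
      ENNReal.ofReal (1 / wirtingerConst (k + 1)) / ENNReal.ofReal (bandwidth Ω)) :
    (∀ (n : ℤ), ∀ l ≤ k, samplingWeight x n l =
      (((x (n + 1) + x n) / 2 - x n) ^ (2 * l + 1) - ((x n + x (n - 1)) / 2 - x n) ^ (2 * l + 1)) /
        ((l.factorial : ℝ) * (2 * l + 1))) ∧
    ∃ φ : ℤ × Fin (k + 1) → bandlimited Ω,
      (∀ (n : ℤ) (l : Fin (k + 1)),
        ((φ (n, l) : Lp ℂ 2 (volume : Measure ℝ)) : ℝ → ℂ) =ᵐ[volume] fun t : ℝ =>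
          (√(samplingWeight x n l) : ℂ) *
            iteratedDeriv l (fun s : ℝ => bandKernel Ω (s - x n)) t) ∧
      (∃ A B : ℝ, 0 < A ∧ 0 < B ∧
        Real.exp (-1) *
          (1 - (wirtingerConst (k + 1) * (samplingDensity x).toReal * bandwidth Ω) ^ (k + 1)) ^ 2
            ≤ A ∧
        B ≤ (1 + 2 * (samplingDensity x).toReal * bandwidth Ω / Real.pi) ^ 2 *
          Real.exp (((samplingDensity x).toReal * bandwidth Ω) ^ 2) ∧
        SamplingInequality Ω x k A B ∧ IsFrameWithBounds φ A B) ∧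
      ∀ A B : ℝ, 0 < A → 0 < B →
        (SamplingInequality Ω x k A B ↔ IsFrameWithBounds φ A B) := by
  have hc : 0 < wirtingerConst (k + 1) := (isLeast_wirtingerConst k.succ_pos).1.1
  have hm := bandwidth_nonneg Ω
  have hfin : samplingDensity x ≠ ⊤ := hδ.ne_top
  have hsmall := wirtingerConst_mul_lt_one hc hm hδ
  refine ⟨fun n l _ => ?_, bandFrame hΩ x k, fun n l => ?_, ?_,
    fun A B hA hB => isFrameWithBounds_bandFrame_iff hΩ x k hA hB⟩
  · rw [samplingWeight_eq hx, cellEnd_succ, cellEnd]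
  · refine (Lp.coeFn_smul _ (frameLp hΩ (x n) l)).trans ?_
    filter_upwards [frameLp_ae_eq hΩ (x n) l] with t ht
    rw [Pi.smul_apply, ht, smul_eq_mul]
  · have hpow : (wirtingerConst (k + 1) * (samplingDensity x).toReal * bandwidth Ω) ^ (k + 1) < 1 :=
      pow_lt_one₀ (by positivity) hsmall k.succ_ne_zero
    have hA : 0 < Real.exp (-1) * (1 - (wirtingerConst (k + 1) * (samplingDensity x).toReal *
        bandwidth Ω) ^ (k + 1)) ^ 2 := mul_pos (Real.exp_pos _) (pow_pos (sub_pos.2 hpow) 2)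
    have hB : 0 < (1 + 2 * (samplingDensity x).toReal * bandwidth Ω / Real.pi) ^ 2 *
        Real.exp (((samplingDensity x).toReal * bandwidth Ω) ^ 2) := by positivity
    have h := (samplingInequality_iff hΩ x k _ _).2 fun f hf => by
      have hF := isBernstein_smoothRep hΩ hf
      have hu := hF.sampling_upper hx hfin k
      have hl := hF.sampling_lower hx hfin k hsmall.le
      rw [integral_norm_sq_smoothRep hΩ hf] at hu hl
      exact ⟨hu.1, hl, hu.2⟩
    -- The frame bounds are the two explicit expressions themselves; the strict density condition is
    -- what makes the lower one positive.
    exact ⟨_, _, hA, hB, le_rfl, le_rfl, h, (isFrameWithBounds_bandFrame_iff hΩ x k hA hB).1 h⟩
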